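/- Let $n\ge 2$, $d\in\mathbb N_0$, masses $m_1,\dots,m_n>0$, constants $Z_{i,j}>0$ ($1\le i<j\le n$) and $\alpha>0$. Let $$M=\Big\{q\in(\mathbb R^d)^n \;\Big|\; \sum_i m_iq_i=0\Big\},\qquad \langle q,q'\rangle=\sum_i m_i\, q_i\cdot q_i',$$ $$\Delta=\{q\in M\mid q_i=q_j \text{ for some } i\ne j\},\qquad \widehat M=M\setminus\Delta,\qquad U:\widehat M\to\mathbb R,\quad U(q)=\sum_{i<j}\frac{Z_{i,j}}{\|q_i-q_j\|^{\alpha}} .$$ For a partition $\mathcal C$ of $\{1,\dots,n\}$ other than the partition into singletons, let $\Delta^E_{\mathcal C}\subseteq M$ be the subspace of those $q$ with $q_i=q_j$ whenever $i,j$ lie in the same block of $\mathcal C$, let $\Delta^I_{\mathcal C}$ be its orthogonal complement in $M$ and $S^I_{\mathcal C}$ the unit sphere of $\Delta^I_{\mathcal C}$, both with respect to $\langle\cdot,\cdot\rangle$, and let $[M:\Delta^E_{\mathcal C}]=\Delta^E_{\mathcal C}\times[0,\infty)\times S^I_{\mathcal C}$. Write $q=q^E_{\mathcal C}+q^I_{\mathcal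 C}$ for the orthogonal decomposition of $q\in M$. The total boundary blow-up $\wideparen M_\Delta$ is the closure of $\hat I_\Delta(\widehat M)$ in $\prod_{\mathcal C}[M:\Delta^E_{\mathcal C}]$, where $$\hat I_\Delta(q)=\big(q^E_{\mathcal C},\,\|q^I_{\mathcal C}\|,\,q^I_{\mathcal C}/\|q^I_{\mathcal C}\|\big)_{\mathcal C}.$$ It carries the smooth structure inherited from this product: its corner charts are the homeomorphisms between open subsets of $\wideparen M_\Delta$ and open subsets of $\mathbb R^m_k=[0,\infty)^k\times\mathbb R^{m-k}$, with $m=(n-1)d$ and $0\le k\le m$, that are smooth in both directions as maps between subsets of Euclidean spaces (that is, locally restrictions of smooth maps). The boundary $\partial\wideparen M_\Delta$ is the closure of the set of points at which exactly one of the first $k$ coordinates of such a chart vanishes. Then $\wideparen M_\Delta$ is an $(n-1)d$-dimensional manifold with corners with $\wideparen M_\Delta\setminus\partial\wideparen M_\Delta=\hat I_\Delta(\widehat M)$. Identify this set with $\widehat M$. There is exactly one function $\rho:\wideparen M_\Delta\to\mathbb R$ with $$\rho|_{\widehat M}=U^{-1/\alpha},\qquad \rho|_{\partial\wideparen M_\Delta}=0,$$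 and it is in the Hölder class $C^{(1+\alpha)}(\wideparen M_\Delta,\mathbb R)$. Here $C^{(s)}=C^{k,\beta}$ with $k=\lceil s\rceil-1$ and $\beta=s-k\in(0,1]$, understood locally: in every corner chart, the function is locally the restriction of a $C^k$ function on an open subset of $\mathbb R^m$ whose $k$-th derivative is $\beta$-Hölder continuous. If $\alpha=1$, then $\rho$ is a boundary defining function in the sense of Melrose: it is smooth on $\wideparen M_\Delta$, vanishes on $\partial\wideparen M_\Delta$, is positive on $\wideparen M_\Delta\setminus\partial\wideparen M_\Delta$, and at each point $p$ at which $k\geq 0$ boundary coordinates vanish there are local coordinates with values in $\mathbb R^m_k$ whose first $k$ entries vanish at $p$ and in which $\rho(x)=a(x)\,x_1\cdots x_k$ near $p$, with $a$ smooth and $a(p)>0$. -/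

import Mathlib

open scoped ContDiff NNReal Topology

namespace NBody

/-! ### Manifolds with corners, as subsets of a normed space -/

section Corners

variable {E F : Type*} [NormedAddCommGroup E] [NormedSpace ℝ E]
  [NormedAddCommGroup F] [NormedSpace ℝ F]

/-- The model cylinder `ℝ^m_k = [0,∞)^k × ℝ^(m-k)`. -/
def cornerModel (m k : ℕ) : Set (EuclideanSpace ℝ (Fin m)) :=
  {x | ∀ i : Fin m, (i : ℕ) < k → 0 ≤ x i}

/-- `f`, defined on the subset `A` of `E`, is smooth on `s ⊆ A`: near every point of `s` it is the
restriction of a smooth map defined on an open subset of `E`. (Smooth partitions of unity in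
finite dimension glue the local extensions to one extension to a neighbourhood of `s`.) -/
def SmoothOnSubset {A : Set E} (f : A → F) (s : Set A) : Prop :=
  ∀ x ∈ s, ∃ W : Set E, IsOpen W ∧ (x : E) ∈ W ∧ ∃ g : E → F, ContDiffOn ℝ ∞ g W ∧
    ∀ y ∈ s, (y : E) ∈ W → f y = g y

/-- `f`, defined on the subset `A` of `E`, is locally of class `C^{k,β}` on `s ⊆ A`: near every
point of `s` it is the restriction of a `C^k` function on an open subset `W` of `E` whose `k`-th
derivative is `β`-Hölder continuous on `W`. -/
def HolderOnSubset (k : ℕ) (β : ℝ≥0) {A : Set E} (f : A → F) (s : Set A) : Prop :=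
  ∀ x ∈ s, ∃ W : Set E, IsOpen W ∧ (x : E) ∈ W ∧ ∃ g : E → F, ContDiffOn ℝ k g W ∧
    (∃ K : ℝ≥0, HolderOnWith K β (iteratedFDeriv ℝ k g) W) ∧
    ∀ y ∈ s, (y : E) ∈ W → f y = g y

/-- An `m`-dimensional corner chart of `X ⊆ E`, with values in `ℝ^m_k`, for the smooth structure
that `X` inherits from `E`: a homeomorphism from an open subset of `X` onto an open subset of
`ℝ^m_k` that is smooth in both directions, as a map between subsets of normed spaces. -/
structure CornerChart (X : Set E) (m k : ℕ) where
  toHomeo : OpenPartialHomeomorph X (cornerModel m k)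
  smooth_toFun : SmoothOnSubset
    (fun x : X => (toHomeo x : EuclideanSpace ℝ (Fin m))) toHomeo.source
  smooth_invFun : SmoothOnSubset
    (fun y : cornerModel m k => (toHomeo.symm y : E)) toHomeo.target

/-- Any two corner charts of `X` are compatible. -/
theorem CornerChart.compatible {X : Set E} {m k l : ℕ}
    (φ : CornerChart X m k) (ψ : CornerChart X m l) :
    SmoothOnSubset
      (fun y : cornerModel m k => (ψ.toHomeo (φ.toHomeo.symm y) : EuclideanSpace ℝ (Fin m)))
      (φ.toHomeo.target ∩ φ.toHomeo.symm ⁻¹' ψ.toHomeo.source) := by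
  rintro x ⟨hx, hx'⟩
  obtain ⟨W, hW, hxW, g, hg, hgy⟩ := φ.smooth_invFun x hx
  obtain ⟨V, hV, hxV, h, hh, hhy⟩ := ψ.smooth_toFun _ hx'
  have hgx : g x = (φ.toHomeo.symm x : E) := (hgy x hx hxW).symm
  refine ⟨W ∩ g ⁻¹' V, hg.continuousOn.isOpen_inter_preimage hW hV, ⟨hxW, ?_⟩, h ∘ g,
    hh.comp (hg.mono Set.inter_subset_left) (fun y hy => hy.2), ?_⟩
  · simpa [hgx] using hxV
  · rintro y ⟨hy, hy'⟩ ⟨hyW, hyV⟩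
    have e : (φ.toHomeo.symm y : E) = g y := hgy y hy hyW
    have hyV' : ((φ.toHomeo.symm y : X) : E) ∈ V := by rw [e]; exact hyV
    rw [Function.comp_apply, ← e]
    exact hhy _ hy' hyV'

/-- `X ⊆ E`, with the structure inherited from `E`, is an `m`-dimensional manifold with corners:
its corner charts cover it. (They are pairwise compatible, and a subspace of a normed space
is Hausdorff and paracompact.) -/
def IsManifoldWithCorners (m : ℕ) (X : Set E) : Prop :=
  ∀ p : X, ∃ k ≤ m, ∃ φ : CornerChart X m k, p ∈ φ.toHomeo.source

/-- `∂_ℓ X`: the points at which, in a chart with values in `ℝ^m_k`, exactly `ℓ` of the first `k`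
coordinates vanish. -/
def depthStratum (m : ℕ) (X : Set E) (l : ℕ) : Set X :=
  {p | ∃ k ≤ m, ∃ φ : CornerChart X m k, p ∈ φ.toHomeo.source ∧
    {i : Fin m | (i : ℕ) < k ∧ (φ.toHomeo p : EuclideanSpace ℝ (Fin m)) i = 0}.ncard = l}

/-- The boundary `∂X`, the closure of `∂_1 X` in `X`. -/
def cornerBoundary (m : ℕ) (X : Set E) : Set X :=
  closure (depthStratum m X 1)

/-- `f ∈ C^∞(X, ℝ)`: smooth in all corner charts. -/
def IsSmoothOnCorners (m : ℕ) {X : Set E} (f : X → ℝ) : Prop :=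
  ∀ k ≤ m, ∀ φ : CornerChart X m k,
    SmoothOnSubset (fun y => f (φ.toHomeo.symm y)) φ.toHomeo.target

/-- `f ∈ C^{(s)}(X, ℝ)` for `s > 0`: in all corner charts, `f` is locally of class `C^{k,β}` with
`k = ⌈s⌉ - 1` and `β = s - k ∈ (0,1]`. -/
def IsHolderOnCorners (s : ℝ) (m : ℕ) {X : Set E} (f : X → ℝ) : Prop :=
  ∀ k ≤ m, ∀ φ : CornerChart X m k,
    HolderOnSubset (⌈s⌉₊ - 1) (s - ((⌈s⌉₊ - 1 : ℕ) : ℝ)).toNNReal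
      (fun y => f (φ.toHomeo.symm y)) φ.toHomeo.target

/-- `f` is a boundary defining function of the manifold with corners `X`: it is smooth, vanishes on
`∂X`, is positive on `X \ ∂X`, and around each `p ∈ X` there are coordinates with values in `ℝ^m_k`,
whose first `k` coordinates vanish at `p` (so `p ∈ ∂_k X`), in which
`f(x) = a(x) x_1 ⋯ x_k` near `p` with `a` smooth and `a(p) > 0`. -/
def IsBoundaryDefiningFunction (m : ℕ) {X : Set E} (f : X → ℝ) : Prop :=
  IsSmoothOnCorners m f ∧ (∀ p ∈ cornerBoundary m X, f p = 0) ∧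
  (∀ p, p ∉ cornerBoundary m X → 0 < f p) ∧
  ∀ p : X, ∃ k ≤ m, ∃ φ : CornerChart X m k, p ∈ φ.toHomeo.source ∧
    (∀ i : Fin m, (i : ℕ) < k → (φ.toHomeo p : EuclideanSpace ℝ (Fin m)) i = 0) ∧
    ∃ W : Set (EuclideanSpace ℝ (Fin m)), IsOpen W ∧
      (φ.toHomeo p : EuclideanSpace ℝ (Fin m)) ∈ W ∧
      ∃ a : EuclideanSpace ℝ (Fin m) → ℝ, ContDiffOn ℝ ∞ a W ∧ 0 < a (φ.toHomeo p) ∧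
        ∀ y ∈ φ.toHomeo.target, (y : EuclideanSpace ℝ (Fin m)) ∈ W →
          f (φ.toHomeo.symm y) = a y *
            ∏ i ∈ Finset.univ.filter (fun i : Fin m => (i : ℕ) < k),
              (y : EuclideanSpace ℝ (Fin m)) i

end Corners

/-! ### Configuration space of `n` particles in `ℝ^d` -/

section Config

variable {n d : ℕ}

/-- `(ℝ^d)^n`. -/
abbrev Config (n d : ℕ) : Type := Fin n → EuclideanSpace ℝ (Fin d)

/-- The mass inner product. -/
noncomputable def massInner (m : Fin n → ℝ) (q q' : Config n d) : ℝ :=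
  ∑ i, m i * inner ℝ (q i) (q' i)

/-- The center of mass configuration space `M`. -/
def comSpace (d : ℕ) (m : Fin n → ℝ) : Set (Config n d) := {q | ∑ i, m i • q i = 0}

/-- The noncollision configuration space `M \ Δ`. -/
def noncollision (d : ℕ) (m : Fin n → ℝ) : Set (Config n d) :=
  {q | q ∈ comSpace d m ∧ ∀ i j, i ≠ j → q i ≠ q j}

/-- The potential `U(q) = ∑_{i<j} Z_{i,j} / ‖q_i - q_j‖^α`. -/
noncomputable def potential (Z : Fin n → Fin n → ℝ) (α : ℝ) (q : Config n d) : ℝ :=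
  ∑ i, ∑ j with i < j, Z i j / ‖q i - q j‖ ^ α

/-- Partitions (cluster decompositions) of `{1,…,n}`. The finest one, `⊥`, consists of
singletons. -/
abbrev Clusters (n : ℕ) : Type := Finpartition (Finset.univ : Finset (Fin n))

/-- The `C`-collision subspace of `M`. -/
def collisionSpace (d : ℕ) (m : Fin n → ℝ) (C : Clusters n) : Set (Config n d) :=
  {q | q ∈ comSpace d m ∧ ∀ i j, C.part i = C.part j → q i = q j}

/-- Its orthogonal complement in `M` with respect to the mass inner product. -/
def internalSpace (d : ℕ) (m : Fin n → ℝ) (C : Clusters n) : Set (Config n d) :=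
  {q | q ∈ comSpace d m ∧ ∀ x ∈ collisionSpace d m C, massInner m q x = 0}

/-- The orthogonal projection `q ↦ q^E_C` of `M` to the collision subspace: every particle
is moved to the barycenter of its cluster. -/
noncomputable def projE (m : Fin n → ℝ) (C : Clusters n) (q : Config n d) : Config n d :=
  fun i => (∑ j ∈ C.part i, m j)⁻¹ • ∑ j ∈ C.part i, m j • q j

/-- The complementary projection `q ↦ q^I_C = q - q^E_C`. -/
noncomputable def projI (m : Fin n → ℝ) (C : Clusters n) (q : Config n d) : Config n d :=
  q - projE m C q

theorem sum_clusters {V : Type*} [AddCommMonoid V] (C : Clusters n) (f : Fin n → V) :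
    ∑ i, f i = ∑ P ∈ C.parts, ∑ i ∈ P, f i := by
  conv_lhs => rw [← C.biUnion_parts]
  rw [Finset.sum_biUnion C.supIndep.pairwiseDisjoint]
  rfl

theorem sum_projI_part (m : Fin n → ℝ) (hm : ∀ i, 0 < m i) (C : Clusters n) (q : Config n d)
    {P : Finset (Fin n)} (hP : P ∈ C.parts) : ∑ i ∈ P, m i • projI m C q i = 0 := by
  have h0 : (∑ j ∈ P, m j) ≠ 0 :=
    (Finset.sum_pos (fun i _ => hm i) (C.nonempty_of_mem_parts hP)).ne'
  have h : ∀ i ∈ P, m i • projI m C q i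
      = m i • q i - m i • ((∑ j ∈ P, m j)⁻¹ • ∑ j ∈ P, m j • q j) := by
    intro i hi
    simp only [projI, projE, Pi.sub_apply, smul_sub, C.part_eq_of_mem hP hi]
  rw [Finset.sum_congr rfl h, Finset.sum_sub_distrib, ← Finset.sum_smul, smul_smul,
    mul_inv_cancel₀ h0, one_smul, sub_self]

/-- `q^I_C` lies in the orthogonal complement of the collision subspace. -/
theorem projI_mem (m : Fin n → ℝ) (hm : ∀ i, 0 < m i) (C : Clusters n) (q : Config n d) :
    projI m C q ∈ internalSpace d m C := by
  refine ⟨?_, ?_⟩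
  · change ∑ i, m i • projI m C q i = 0
    rw [sum_clusters C]
    exact Finset.sum_eq_zero fun P hP => sum_projI_part m hm C q hP
  · rintro x ⟨-, hx⟩
    rw [massInner, sum_clusters C]
    refine Finset.sum_eq_zero fun P hP => ?_
    obtain ⟨i₀, hi₀⟩ := C.nonempty_of_mem_parts hP
    have h : ∀ i ∈ P, m i * inner ℝ (projI m C q i) (x i)
        = inner ℝ (m i • projI m C q i) (x i₀) := by
      intro i hi
      rw [hx i i₀ (by rw [C.part_eq_of_mem hP hi, C.part_eq_of_mem hP hi₀]), real_inner_smul_left]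
    rw [Finset.sum_congr rfl h, ← sum_inner, sum_projI_part m hm C q hP, inner_zero_left]

/-- `q^E_C` lies in the collision subspace. -/
theorem projE_mem (m : Fin n → ℝ) (hm : ∀ i, 0 < m i) (C : Clusters n) (q : Config n d)
    (hq : q ∈ comSpace d m) : projE m C q ∈ collisionSpace d m C := by
  refine ⟨?_, fun i j h => by simp only [projE, h]⟩
  have h1 : ∑ i, m i • projI m C q i = 0 := (projI_mem m hm C q).1
  have h2 : ∑ i, m i • q i = 0 := hq
  change ∑ i, m i • projE m C q i = 0
  simpa [projI, smul_sub, Finset.sum_sub_distrib, h2] using h1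

/-! ### The blow-up -/

/-- The space containing `[M : Δ_C] = Δ_C × [0,∞) × S_C`; points are triples `(q^E, r, Q)`. -/
abbrev BlowUpAmbient (n d : ℕ) : Type := Config n d × ℝ × Config n d

/-- The blow-up `[M : Δ_C] = Δ_C × [0,∞) × S_C` of `M` along the collision subspace `Δ_C`, where
`S_C` is the unit sphere, for the mass inner product, of the orthogonal complement of `Δ_C`. -/
def blowUp (d : ℕ) (m : Fin n → ℝ) (C : Clusters n) : Set (BlowUpAmbient n d) :=
  {x | x.1 ∈ collisionSpace d m C ∧ 0 ≤ x.2.1 ∧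
    x.2.2 ∈ internalSpace d m C ∧ massInner m x.2.2 x.2.2 = 1}

/-- The index set of the blow-up: all partitions but the finest one. -/
abbrev CollisionClusters (n : ℕ) : Type := {C : Clusters n // C ≠ ⊥}

/-- The diagonal map `q ↦ (q)_C`, where `q` is written in the coordinates of `[M : Δ_C]`, that is,
as `(q^E, r, Q)` with `q = q^E + r Q` and `r` the mass norm of `q^I`. -/
noncomputable def diagonalMap (m : Fin n → ℝ) (q : Config n d) :
    CollisionClusters n → BlowUpAmbient n d :=
  fun C =>
    let r := √(massInner m (projI m C.1 q) (projI m C.1 q))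
    (projE m C.1 q, r, r⁻¹ • projI m C.1 q)

/-- The total boundary blow-up (graph blow-up): the closure, in the product of the `[M : Δ_C]`, of
the image of the noncollision configuration space. -/
def totalBlowUp (d : ℕ) (m : Fin n → ℝ) : Set (CollisionClusters n → BlowUpAmbient n d) :=
  {x | (∀ C, x C ∈ blowUp d m C.1) ∧ x ∈ closure (diagonalMap m '' noncollision d m)}

/-- `ρ` is the function on the total blow-up that equals `U^{-1/α}` on the noncollision
configuration space, seen as a subset of the blow-up, and `0` on the boundary. -/
def IsRho (m : Fin n → ℝ) (Z : Fin n → Fin n → ℝ) (α : ℝ) (ρ : totalBlowUp d m → ℝ) : Prop :=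
  (∀ q ∈ noncollision d m, ∀ p : totalBlowUp d m, (p : CollisionClusters n → BlowUpAmbient n d) =
    diagonalMap m q → ρ p = potential Z α q ^ (-1 / α)) ∧
  ∀ p ∈ cornerBoundary ((n - 1) * d) (totalBlowUp d m), ρ p = 0

theorem massInner_self_pos (m : Fin n → ℝ) (hm : ∀ i, 0 < m i) (q : Config n d) (hq : q ≠ 0) :
    0 < massInner m q q := by
  obtain ⟨i, hi⟩ := Function.ne_iff.mp hq
  refine Finset.sum_pos' (fun j _ => mul_nonneg (hm j).le real_inner_self_nonneg)
    ⟨i, Finset.mem_univ i, mul_pos (hm i) ?_⟩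
  rw [real_inner_self_eq_norm_sq]
  exact pow_pos (norm_pos_iff.mpr hi) 2

theorem massInner_smul_smul (m : Fin n → ℝ) (c : ℝ) (q : Config n d) :
    massInner m (c • q) (c • q) = c ^ 2 * massInner m q q := by
  simp only [massInner, Pi.smul_apply, real_inner_smul_left, real_inner_smul_right, Finset.mul_sum]
  exact Finset.sum_congr rfl fun i _ => by ring

/-- The diagonal map takes noncollision configurations to the total blow-up. -/
theorem diagonalMap_mem (m : Fin n → ℝ) (hm : ∀ i, 0 < m i) (q : Config n d)
    (hq : q ∈ noncollision d m) : diagonalMap m q ∈ totalBlowUp d m := by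
  refine ⟨fun C => ?_, subset_closure ⟨q, hq, rfl⟩⟩
  have hI := projI_mem m hm C.1 q
  have hne : projI m C.1 q ≠ 0 := by
    intro h
    apply C.2
    have hE : q = projE m C.1 q := sub_eq_zero.mp h
    have hinj : ∀ i j, C.1.part i = C.1.part j → i = j := by
      intro i j hij
      by_contra hne
      apply hq.2 i j hne
      rw [hE]
      exact (projE_mem m hm C.1 q hq.1).2 i j hij
    refine le_bot_iff.mp fun P hP => ?_
    obtain ⟨i, hi⟩ := C.1.nonempty_of_mem_parts hP
    refine ⟨{i}, by simp, ?_⟩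
    intro j hj
    have := hinj j i (by rw [C.1.part_eq_of_mem hP hi, C.1.part_eq_of_mem hP hj])
    simp [this]
  have hpos := massInner_self_pos m hm _ hne
  refine ⟨projE_mem m hm C.1 q hq.1, Real.sqrt_nonneg _, ⟨?_, ?_⟩, ?_⟩
  · have := hI.1
    simp only [comSpace, Set.mem_ofPred_eq] at this ⊢
    simp only [diagonalMap, Pi.smul_apply, smul_comm (m _) (_ : ℝ), ← Finset.smul_sum, this,
      smul_zero]
  · intro x hx
    have := hI.2 x hx
    simp only [massInner] at this
    simp only [diagonalMap, massInner, Pi.smul_apply, real_inner_smul_left]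
    simp only [mul_left_comm (m _), ← Finset.mul_sum, this, mul_zero]
  · simp only [diagonalMap, massInner_smul_smul, inv_pow, Real.sq_sqrt hpos.le]
    exact inv_mul_cancel₀ hpos.ne'

end Config

end NBody

open NBody

open scoped ContDiff NNReal Topology

/-! Near a point p of the blow-up, particles collide on a hierarchy of scales. The blow-down of p
has a coincidence partition `D 0`. The spherical component `v 0` of p at `D 0` splits its clusters
into those of `D 1`, the component `v 1` at `D 1` splits these further, and after k steps only
singletons remain (`exists_flag`). Nearby configurations are written as q = c₀ + t₀ (c₁ + t₁ (c₂ + ⋯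
+ t_{k-1} c_k)), where c_l is constant on the clusters of `D l`, c_{l+1} is centred on those of `D
l`, and ⟨c_{l+1}, v_l⟩ = 1. All of this is driven by one parameter y in M: t_l = ⟨y, v_l⟩ is a
scale, and the other components of y perturb the shapes c_l.

For every partition C ≠ ⊥, the first `lev C` summands are constant on the clusters of C, so q^I_C =
t₀ ⋯ t_{lev C - 1} B_C(y) with B_C smooth and nonzero near the base point. Hence each component of
the diagonal map extends smoothly to vanishing scales (`param`), and y is recovered smoothly from
the components at the `D l` (`recon`, `seen`). The v_l are orthonormal, so orthonormal coordinates
of M that start with t₀, …, t_{k-1} give a corner chart in which the noncollision configurations are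
the points with all t_l > 0.

The same scaling holds for q_i - q_j. Extracting the total scale from U gives U^{-1/α} = t₀ ⋯
t_{k-1} H(t₀^α, …, t_{k-1}^α, y) with H smooth and positive at p, because a pair that separates only
at the last level contributes a positive term even at t = 0 (`hasCornerForm`). For α = 1 this is the
formula for a boundary defining function. For general α, each derivative costs at most one power of
each t_j (`hasFDerivAt_powTerm`); after ⌈α⌉ derivatives the remaining fractional powers have
exponent at least 1 + α - ⌈α⌉, the required Hölder exponent (`holderNear_powTerm`). That the
boundary is the complement of the noncollision configurations rests on the invariance of boundary
points under smooth chart changes (`CornerChart.notMem_depthStratum_one`). -/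

namespace NBody

/-! ### Local Hölder classes and their closure properties. -/

section Holder

variable {E F : Type} [NormedAddCommGroup E] [NormedSpace ℝ E]
  [NormedAddCommGroup F] [NormedSpace ℝ F]

/-- `f` is of class `C^{k,β}` on a neighbourhood of `x`. -/
def HolderNear (k : ℕ) (β : ℝ≥0) (f : E → F) (x : E) : Prop :=
  ∃ W : Set E, IsOpen W ∧ x ∈ W ∧ ContDiffOn ℝ k f W ∧
    ∃ K : ℝ≥0, HolderOnWith K β (iteratedFDeriv ℝ k f) W

theorem HolderNear.congr {k : ℕ} {β : ℝ≥0} {f g : E → F} {x : E}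
    (hg : HolderNear k β g x) (h : f =ᶠ[𝓝 x] g) : HolderNear k β f x := by
  obtain ⟨W, hW, hx, hc, K, hK⟩ := hg
  obtain ⟨V, hV, hVo, hxV⟩ := eventually_nhds_iff.mp h
  refine ⟨W ∩ V, hW.inter hVo, ⟨hx, hxV⟩,
    (hc.mono Set.inter_subset_left).congr fun y hy => hV y hy.2, K, ?_⟩
  have e : ∀ y ∈ W ∩ V, iteratedFDeriv ℝ k f y = iteratedFDeriv ℝ k g y := fun y hy =>
    (Filter.EventuallyEq.iteratedFDeriv ℝ
      (eventually_nhds_iff.mpr ⟨V, hV, hVo, hy.2⟩ : f =ᶠ[𝓝 y] g) k).self_of_nhds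
  intro y hy z hz
  rw [e y hy, e z hz]
  exact hK y hy.1 z hz.1

theorem HolderNear.add {k : ℕ} {β : ℝ≥0} {f g : E → F} {x : E}
    (hf : HolderNear k β f x) (hg : HolderNear k β g x) :
    HolderNear k β (fun y => f y + g y) x := by
  obtain ⟨W, hW, hx, hc, K, hK⟩ := hf
  obtain ⟨V, hV, hxV, hc', K', hK'⟩ := hg
  have hf' : ∀ y ∈ W ∩ V, ContDiffAt ℝ k f y := fun y hy => hc.contDiffAt (hW.mem_nhds hy.1)
  have hg' : ∀ y ∈ W ∩ V, ContDiffAt ℝ k g y := fun y hy => hc'.contDiffAt (hV.mem_nhds hy.2)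
  refine ⟨W ∩ V, hW.inter hV, ⟨hx, hxV⟩,
    fun y hy => ((hf' y hy).add (hg' y hy)).contDiffWithinAt, K + K', ?_⟩
  intro y hy z hz
  change edist (iteratedFDeriv ℝ k (f + g) y) (iteratedFDeriv ℝ k (f + g) z) ≤ _
  rw [iteratedFDeriv_add_apply (hf' y hy) (hg' y hy),
    iteratedFDeriv_add_apply (hf' z hz) (hg' z hz)]
  refine (edist_add_add_le _ _ _ _).trans ?_
  rw [ENNReal.coe_add, add_mul]
  exact add_le_add (hK y hy.1 z hz.1) (hK' y hy.2 z hz.2)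

theorem holderNear_zero (k : ℕ) (β : ℝ≥0) (x : E) : HolderNear k β (fun _ : E => (0 : F)) x := by
  refine ⟨Set.univ, isOpen_univ, Set.mem_univ _, contDiffOn_const, 0, ?_⟩
  intro y _ z _
  have : iteratedFDeriv ℝ k (fun _ : E => (0 : F)) = 0 := iteratedFDeriv_fun_zero
  simp [this]

theorem HolderNear.sum {ι : Type*} (s : Finset ι) {k : ℕ} {β : ℝ≥0} {f : ι → E → F} {x : E}
    (hf : ∀ i ∈ s, HolderNear k β (f i) x) : HolderNear k β (fun y => ∑ i ∈ s, f i y) x := by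
  classical
  induction s using Finset.induction_on with
  | empty => simpa using holderNear_zero k β x
  | insert i s hi ih =>
    simp only [Finset.sum_insert hi]
    exact (hf i (by simp)).add (ih fun j hj => hf j (by simp [hj]))

/-- Carries the induction on the order of differentiability: `iteratedFDeriv` of order k + 1 is, up
to an isometry, that of order k of the derivative. -/
theorem HolderNear.of_hasFDerivAt {k : ℕ} {β : ℝ≥0} {f : E → F} {f' : E → E →L[ℝ] F} {x : E}
    (h : ∀ᶠ y in 𝓝 x, HasFDerivAt f (f' y) y) (hf : HolderNear k β f' x) :
    HolderNear (k + 1) β f x := by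
  have hf : HolderNear k β (fderiv ℝ f) x :=
    hf.congr (h.mono fun y hy => hy.fderiv)
  obtain ⟨W, hW, hx, hc, K, hK⟩ := hf
  obtain ⟨V, hV, hVo, hxV⟩ := eventually_nhds_iff.mp h
  refine ⟨W ∩ V, hW.inter hVo, ⟨hx, hxV⟩, ?_, K, ?_⟩
  · rw [show ((k + 1 : ℕ) : WithTop ℕ∞) = (k : WithTop ℕ∞) + 1 by push_cast; rfl,
      contDiffOn_succ_iff_fderiv_of_isOpen (hW.inter hVo)]
    refine ⟨fun y hy => (hV y hy.2).differentiableAt.differentiableWithinAt, ?_,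
      hc.mono Set.inter_subset_left⟩
    intro h
    exact absurd h (by simp)
  · intro y hy z hz
    rw [iteratedFDeriv_succ_eq_comp_right, iteratedFDeriv_succ_eq_comp_right]
    simp only [Function.comp_apply]
    rw [LinearIsometryEquiv.edist_map]
    exact hK y hy.1 z hz.1

/-- `f` is `β`-Hölder continuous on a neighbourhood of `x`. -/
def LocHolder {X Y : Type*} [PseudoEMetricSpace X] [PseudoEMetricSpace Y] (β : ℝ≥0) (f : X → Y)
    (x : X) : Prop :=
  ∃ s ∈ 𝓝 x, ∃ K : ℝ≥0, HolderOnWith K β f s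

theorem LocHolder.holderNear {β : ℝ≥0} (hβ : 0 < β) {f : E → F} {x : E} (h : LocHolder β f x) :
    HolderNear 0 β f x := by
  obtain ⟨s, hs, K, hK⟩ := h
  refine ⟨interior s, isOpen_interior, mem_interior_iff_mem_nhds.mpr hs, ?_, K, ?_⟩
  · exact contDiffOn_zero.mpr ((hK.continuousOn hβ).mono interior_subset)
  · intro y hy z hz
    rw [iteratedFDeriv_zero_eq_comp]
    simp only [Function.comp_apply]
    rw [LinearIsometryEquiv.edist_map]
    exact hK y (interior_subset hy) z (interior_subset hz)

/-- On a bounded set a Lipschitz bound implies a β-Hölder bound; the unit ball, of diameter at most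
2, provides the boundedness. -/
theorem locHolder_of_contDiffAt {β : ℝ≥0} (hβ : β ≤ 1) {f : E → F} {x : E}
    (h : ContDiffAt ℝ 1 f x) : LocHolder β f x := by
  obtain ⟨K, t, ht, hK⟩ := h.exists_lipschitzOnWith
  have h1 : HolderOnWith K 1 f (t ∩ Metric.ball x 1) :=
    (holderOnWith_one.mpr hK).mono Set.inter_subset_left
  refine ⟨t ∩ Metric.ball x 1, Filter.inter_mem ht (Metric.ball_mem_nhds x one_pos), _,
    h1.of_le (D := 2) (fun y hy z hz => ?_) hβ⟩
  rw [edist_dist]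
  refine (ENNReal.ofReal_le_ofReal (q := 2) ?_).trans (by simp)
  have := dist_triangle_right y z x
  have h2 := Metric.mem_ball.mp hy.2
  have h3 := Metric.mem_ball.mp hz.2
  linarith

theorem LocHolder.prodMk {X Y Z : Type*} [PseudoEMetricSpace X] [PseudoEMetricSpace Y]
    [PseudoEMetricSpace Z] {β : ℝ≥0} {f : X → Y} {g : X → Z} {x : X}
    (hf : LocHolder β f x) (hg : LocHolder β g x) : LocHolder β (fun y => (f y, g y)) x := by
  obtain ⟨s, hs, K, hK⟩ := hf
  obtain ⟨t, ht, L, hL⟩ := hg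
  refine ⟨s ∩ t, Filter.inter_mem hs ht, max K L, fun y hy z hz => ?_⟩
  rw [Prod.edist_eq]
  refine max_le ((hK y hy.1 z hz.1).trans ?_) ((hL y hy.2 z hz.2).trans ?_) <;> gcongr <;> simp

theorem LocHolder.pi {X ι : Type*} {Y : ι → Type*} [Fintype ι] [PseudoEMetricSpace X]
    [∀ i, PseudoEMetricSpace (Y i)] {β : ℝ≥0} {f : ∀ i, X → Y i} {x : X}
    (hf : ∀ i, LocHolder β (f i) x) : LocHolder β (fun y i => f i y) x := by
  choose s hs K hK using hf
  refine ⟨⋂ i, s i, Filter.iInter_mem.mpr hs, ∑ i, K i, fun y hy z hz => ?_⟩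
  refine edist_pi_le_iff.mpr fun i => ?_
  refine (hK i y (Set.mem_iInter.mp hy i) z (Set.mem_iInter.mp hz i)).trans ?_
  gcongr
  exact Finset.single_le_sum (f := K) (fun _ _ => zero_le) (Finset.mem_univ i)

theorem LocHolder.comp_left {X Y Z : Type*} [PseudoEMetricSpace X] [PseudoEMetricSpace Y]
    [PseudoEMetricSpace Z] {β γ : ℝ≥0} (hβ : 0 < β) {g : Y → Z} {f : X → Y} {x : X}
    (hg : LocHolder γ g (f x)) (hf : LocHolder β f x) :
    LocHolder (γ * β) (g ∘ f) x := by
  obtain ⟨s, hs, K, hK⟩ := hf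
  obtain ⟨t, ht, L, hL⟩ := hg
  have hc : ContinuousAt f x := (hK.continuousOn hβ).continuousAt hs
  exact ⟨s ∩ f ⁻¹' t, Filter.inter_mem hs (hc ht), _,
    hL.comp (hK.mono Set.inter_subset_left) fun y hy => hy.2⟩

/-- Follows from the subadditivity of s ↦ s^β on [0,∞) for β ≤ 1, the positive part being monotone
and 1-Lipschitz. -/
theorem holderWith_max_zero_rpow {β : ℝ≥0} (hβ : β ≤ 1) :
    HolderWith 1 β (fun t : ℝ => (max t 0) ^ (β : ℝ)) := by
  have key : ∀ a b : ℝ, b ≤ a → |(max a 0) ^ (β : ℝ) - (max b 0) ^ (β : ℝ)| ≤ |a - b| ^ (β : ℝ) := by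
    intro a b hab
    have hm : max b 0 ≤ max a 0 := max_le_max_right 0 hab
    have hb : (0 : ℝ) ≤ max b 0 := le_max_right _ _
    rw [abs_of_nonneg (sub_nonneg.mpr (Real.rpow_le_rpow hb hm β.coe_nonneg)),
      abs_of_nonneg (sub_nonneg.mpr hab)]
    have h1 := Real.rpow_add_le_add_rpow (p := (β : ℝ)) hb (sub_nonneg.mpr hm) β.coe_nonneg (by exact_mod_cast hβ)
    have h2 : max a 0 - max b 0 ≤ a - b := by
      rcases max_cases a 0 with h | h <;> rcases max_cases b 0 with h' | h' <;> linarith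
    have h3 := Real.rpow_le_rpow (sub_nonneg.mpr hm) h2 β.coe_nonneg
    rw [add_sub_cancel] at h1
    linarith
  intro a b
  rw [edist_dist, edist_dist, ENNReal.ofReal_rpow_of_nonneg dist_nonneg β.coe_nonneg, ENNReal.coe_one,
    one_mul]
  refine ENNReal.ofReal_le_ofReal ?_
  rw [Real.dist_eq, Real.dist_eq]
  rcases le_total b a with h | h
  · exact key a b h
  · rw [abs_sub_comm, abs_sub_comm a b]
    exact key b a h

end Holder

/-! ### Hölder regularity of products of powers times smooth functions of `t_+^α`. -/

section PowerProducts

set_option linter.unusedSectionVars false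

/-- The weights `τ_c`: up to constants, the derivatives of order `c` of `t` (for `c ≤ 1`) and of
`t_+^(1+α)` (for `c ≥ 2`). -/
noncomputable def powWeight (α : ℝ) : ℕ → ℝ → ℝ
  | 0, t => t
  | 1, _ => 1
  | c + 2, t => (max t 0) ^ (α - 1 - c)

/-- `a` in the formula `τ_c' = a τ_{c+1}` for `τ = powWeight α`. -/
noncomputable def powCoeff (α : ℝ) : ℕ → ℝ
  | 0 => 1
  | 1 => 0
  | c + 2 => α - 1 - c

/-- `b` in the formula `τ_c · (t_+^α)' = α b(t_+^α) τ_{c+1}` for `τ = powWeight α`. -/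
noncomputable def powShift : ℕ → ℝ → ℝ
  | 1, _ => 1
  | _, s => s

theorem contDiff_powShift (c : ℕ) : ContDiff ℝ ∞ (powShift c) := by
  rcases c with _ | _ | c
  · exact contDiff_id
  · exact contDiff_const
  · exact contDiff_id

theorem continuous_max_zero_rpow {a : ℝ} (ha : 0 ≤ a) :
    Continuous fun t : ℝ => (max t 0) ^ a :=
  (continuous_id.max continuous_const).rpow_const fun _ => Or.inr ha

theorem continuous_powWeight {α : ℝ} {c : ℕ} (hc : (c : ℝ) < α + 1) :
    Continuous (powWeight α c) := by
  rcases c with _ | _ | c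
  · exact continuous_id
  · exact continuous_const
  · push_cast at hc
    exact continuous_max_zero_rpow (by linarith)

theorem hasDerivAt_max_zero_rpow {a t : ℝ} (h : 1 < a ∨ t ≠ 0) :
    HasDerivAt (fun t : ℝ => (max t 0) ^ a) (if t ≤ 0 then 0 else a * t ^ (a - 1)) t := by
  rcases lt_trichotomy t 0 with ht | rfl | ht
  · rw [if_pos ht.le]
    refine (hasDerivAt_const t ((0 : ℝ) ^ a)).congr_of_eventuallyEq ?_
    filter_upwards [gt_mem_nhds ht] with s hs
    rw [max_eq_right hs.le]
  · have ha : 1 < a := h.resolve_right (by simp)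
    rw [if_pos le_rfl]
    have h1 : HasDerivWithinAt (fun t : ℝ => (max t 0) ^ a) 0 (Set.Ici 0) 0 := by
      have := (Real.hasDerivAt_rpow_const (x := 0) (p := a) (Or.inr ha.le)).hasDerivWithinAt
        (s := Set.Ici 0)
      rw [Real.zero_rpow (by linarith), mul_zero] at this
      refine this.congr (fun s hs => by rw [max_eq_left (Set.mem_Ici.mp hs)]) (by simp)
    have h2 : HasDerivWithinAt (fun t : ℝ => (max t 0) ^ a) 0 (Set.Iic 0) 0 := by
      refine (hasDerivWithinAt_const 0 _ ((0 : ℝ) ^ a)).congr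
        (fun s hs => by rw [max_eq_right (Set.mem_Iic.mp hs)]) (by simp)
    have := h2.union h1
    rwa [Set.Iic_union_Ici, hasDerivWithinAt_univ] at this
  · rw [if_neg ht.not_ge]
    refine (Real.hasDerivAt_rpow_const (Or.inl ht.ne')).congr_of_eventuallyEq ?_
    filter_upwards [lt_mem_nhds ht] with s hs
    rw [max_eq_left hs.le]

/-- The derivative of `t ↦ t_+^a`. -/
noncomputable def powDeriv (a t : ℝ) : ℝ := if t ≤ 0 then 0 else a * t ^ (a - 1)

theorem hasDerivAt_powWeight {α : ℝ} {c : ℕ} (hc : (c : ℝ) < α) {t : ℝ} :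
    HasDerivAt (powWeight α c) (powCoeff α c * powWeight α (c + 1) t) t := by
  rcases c with _ | _ | c
  · exact (hasDerivAt_id' t).congr_deriv (show (1 : ℝ) = 1 * 1 by norm_num)
  · exact (hasDerivAt_const t (1 : ℝ)).congr_deriv (zero_mul _).symm
  · push_cast at hc
    refine HasDerivAt.congr_deriv (f := powWeight α (c + 2))
      (hasDerivAt_max_zero_rpow (a := α - 1 - c) (t := t) (Or.inl (by linarith))) ?_
    change _ = (α - 1 - c) * (max t 0) ^ (α - 1 - ((c + 1 : ℕ) : ℝ))
    push_cast
    split_ifs with h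
    · rw [max_eq_right h, Real.zero_rpow (by linarith), mul_zero]
    · rw [max_eq_left (not_le.mp h).le]
      congr 2
      ring

/-- For t > 0 the left side is t · α t^(α-1) = α t^α for c = 0, α t^(α-1) for c = 1, and t^(α+1-c) ·
α t^(α-1) = α t^α · t^(α-c) for c ≥ 2. Only c = 1 leaves no factor t^α to absorb into the smooth
coefficient. For t ≤ 0 both sides vanish. -/
theorem powWeight_mul_powDeriv {α : ℝ} (hα : 0 < α) {c : ℕ} (hc : (c : ℝ) < α) {t : ℝ}
    (h : c ≠ 0 ∨ t ≠ 0) :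
    powWeight α c t * powDeriv α t
      = α * powShift c ((max t 0) ^ α) * powWeight α (c + 1) t := by
  unfold powDeriv
  rcases c with _ | _ | c
  · simp only [powWeight, powShift]
    split_ifs with ht
    · simp [max_eq_right ht, Real.zero_rpow hα.ne']
    · have ht' := not_le.mp ht
      rw [max_eq_left ht'.le, mul_left_comm, Real.rpow_sub_one ht'.ne']
      field_simp
  · simp only [powWeight, powShift]
    push_cast at hc
    split_ifs with ht
    · rw [max_eq_right ht, Real.zero_rpow (by push_cast; linarith)]
      ring
    · rw [max_eq_left (not_le.mp ht).le]
      push_cast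
      simp
  · simp only [powWeight, powShift]
    push_cast at hc
    split_ifs with ht
    · simp [max_eq_right ht, Real.zero_rpow hα.ne']
    · have ht' := not_le.mp ht
      rw [max_eq_left ht'.le, mul_left_comm, mul_assoc, ← Real.rpow_add ht', ← Real.rpow_add ht']
      push_cast
      congr 2
      ring

variable {J : Type} [Fintype J] [DecidableEq J] {E F : Type} [NormedAddCommGroup E]
  [NormedSpace ℝ E] [NormedAddCommGroup F] [NormedSpace ℝ F]

/-- The map `y ↦ ((l_j(y)_+^α)_j, y)`. -/
noncomputable def powGraph (α : ℝ) (l : J → E → ℝ) (y : E) : (J → ℝ) × E :=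
  (fun j => (max (l j y) 0) ^ α, y)

/-- The function `y ↦ ∏_j τ_{c_j}(l_j(y)) H((l_j(y)_+^α)_j, y)`. -/
noncomputable def powTerm (α : ℝ) (l : J → E → ℝ) (c : J → ℕ) (H : (J → ℝ) × E → F) (y : E) : F :=
  (∏ j, powWeight α (c j) (l j y)) • H (powGraph α l y)

/-- The coefficient function of the part of the derivative of `powTerm` in which the `j`-th weight
moves up. -/
noncomputable def powTermDeriv (α : ℝ) (l : J → E → ℝ) (c : J → ℕ) (H : (J → ℝ) × E → F) (j : J)
    (z : (J → ℝ) × E) : E →L[ℝ] F :=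
  (fderiv ℝ (l j) z.2).smulRight
    (powCoeff α (c j) • H z + (α * powShift (c j) (z.1 j)) • fderiv ℝ H z (Pi.single j 1, 0))

theorem continuousAt_powGraph {α : ℝ} (hα : 0 < α) {l : J → E → ℝ} {y : E}
    (hl : ∀ j, ContinuousAt (l j) y) : ContinuousAt (powGraph α l) y :=
  (continuousAt_pi.mpr fun j =>
    ((continuous_max_zero_rpow hα.le).continuousAt).comp (hl j)).prodMk continuousAt_id

/-- Mere continuity of g suffices, since f(z) = O(z - y) makes f(z) (g(z) - g(y)) an o(z - y). -/
theorem hasFDerivAt_smul_of_eq_zero {f : E → ℝ} {f' : E →L[ℝ] ℝ} {g : E → F} {y : E}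
    (hf : HasFDerivAt f f' y) (h0 : f y = 0) (hg : ContinuousAt g y) :
    HasFDerivAt (fun z => f z • g z) (f'.smulRight (g y)) y := by
  have h1 : HasFDerivAt (fun z => f z • g y) (f'.smulRight (g y)) y := hf.smul_const (g y)
  have h2 : HasFDerivAt (fun z => f z • (g z - g y)) (0 : E →L[ℝ] F) y := by
    rw [hasFDerivAt_iff_isLittleO]
    have ho : (fun z => f z) =O[𝓝 y] fun z => z - y := by
      simpa [h0] using hf.isBigO_sub
    have hs : (fun z => g z - g y) =o[𝓝 y] fun _ => (1 : ℝ) := by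
      rw [Asymptotics.isLittleO_one_iff]
      have := Filter.Tendsto.sub_const hg (g y)
      rwa [sub_self] at this
    have := ho.norm_right.smul_isLittleO hs
    simp only [smul_eq_mul, mul_one] at this
    simpa [h0] using this.norm_right
  have := h1.add h2
  simp only [add_zero] at this
  refine this.congr_of_eventuallyEq (Filter.Eventually.of_forall fun z => ?_)
  simp only [Pi.add_apply]
  rw [← smul_add, add_sub_cancel]

/-- The class of functions `powTerm` is closed under differentiation: a derivative hits a weight, or
H through `l j` to the power α, and in both cases the j-th weight moves up by one; or it hits H
through y, and the weights stay. -/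
theorem hasFDerivAt_powTerm {α : ℝ} (hα : 0 < α) {l : J → E → ℝ} {c : J → ℕ}
    {H : (J → ℝ) × E → F} {y : E} (hc : ∀ j, (c j : ℝ) < α)
    (hl : ∀ j, DifferentiableAt ℝ (l j) y) (hH : DifferentiableAt ℝ H (powGraph α l y)) :
    HasFDerivAt (powTerm α l c H)
      (∑ j, powTerm α l (Function.update c j (c j + 1)) (powTermDeriv α l c H j) y
        + powTerm α l c (fun z => (fderiv ℝ H z).comp (ContinuousLinearMap.inr ℝ (J → ℝ) E)) y)
      y := by
  have hW : ∀ j, HasFDerivAt (fun y => powWeight α (c j) (l j y))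
      ((powCoeff α (c j) * powWeight α (c j + 1) (l j y)) • fderiv ℝ (l j) y) y := fun j =>
    (hasDerivAt_powWeight (hc j)).comp_hasFDerivAt y (hl j).hasFDerivAt
  have hprod : ∀ j, ∏ i, powWeight α (Function.update c j (c j + 1) i) (l i y)
      = powWeight α (c j + 1) (l j y) * ∏ i ∈ Finset.univ.erase j, powWeight α (c i) (l i y) := by
    intro j
    rw [← Finset.mul_prod_erase _ _ (Finset.mem_univ j), Function.update_self]
    congr 1
    refine Finset.prod_congr rfl fun i hi => ?_
    rw [Function.update_of_ne (Finset.ne_of_mem_erase hi)]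
  -- At such a point `t_+^α` need not be differentiable, but the vanishing linear weight `l i` makes
  -- continuity of the other factors enough. Only the term with the i-th weight raised survives, and
  -- its `powShift` part vanishes because 0^α = 0.
  by_cases hz : ∃ i, c i = 0 ∧ l i y = 0
  · obtain ⟨i, hi, hi0⟩ := hz
    have hprod0 : ∀ c' : J → ℕ, c' i = 0 → ∏ j, powWeight α (c' j) (l j y) = 0 := fun c' h =>
      Finset.prod_eq_zero (Finset.mem_univ i) (by simp [h, powWeight, hi0])
    have hcont : ContinuousAt (fun y => (∏ j ∈ Finset.univ.erase i, powWeight α (c j) (l j y))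
        • H (powGraph α l y)) y := by
      refine ContinuousAt.smul (tendsto_finsetProd _ fun j _ => ?_)
        (hH.continuousAt.comp_of_eq
          (continuousAt_powGraph hα fun j => (hl j).continuousAt) rfl)
      exact ((continuous_powWeight (by linarith [hc j])).continuousAt).comp (hl j).continuousAt
    have := hasFDerivAt_smul_of_eq_zero (hl i).hasFDerivAt hi0 hcont
    convert this using 1
    · ext z
      rw [powTerm, ← Finset.mul_prod_erase _ _ (Finset.mem_univ i), hi, smul_smul]
      rfl
    · rw [Finset.sum_eq_single i]
      · ext v
        simp only [powTerm, hprod0 c hi, zero_smul, add_zero, hprod, powTermDeriv]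
        simp only [hi, powGraph, powShift, hi0, max_self, Real.zero_rpow hα.ne', powCoeff,
          powWeight]
        simp [smul_smul, mul_comm]
      · intro j _ hj
        simp [powTerm, hprod0 _ (show Function.update c j (c j + 1) i = 0 by
          rw [Function.update_of_ne hj.symm, hi])]
      · simp
  · push Not at hz
    have hz' : ∀ i, c i ≠ 0 ∨ l i y ≠ 0 := fun i => by
      by_cases h : c i = 0
      · exact Or.inr (hz i h)
      · exact Or.inl h
    have hσ : ∀ i, HasFDerivAt (fun y => (max (l i y) 0) ^ α)
        (powDeriv α (l i y) • fderiv ℝ (l i) y) y := by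
      intro i
      refine (hasDerivAt_max_zero_rpow ?_).comp_hasFDerivAt y (hl i).hasFDerivAt
      -- If c i ≥ 1, then c i < α forces α > 1, and `t_+^α` is differentiable at 0 as well.
      rcases hz' i with h | h
      · left
        have : (1 : ℝ) ≤ c i := by exact_mod_cast Nat.one_le_iff_ne_zero.mpr h
        linarith [hc i]
      · exact Or.inr h
    have hg : HasFDerivAt (powGraph α l)
        ((ContinuousLinearMap.pi fun i => powDeriv α (l i y) • fderiv ℝ (l i) y).prod
          (ContinuousLinearMap.id ℝ E)) y :=
      (hasFDerivAt_pi.mpr hσ).prodMk (hasFDerivAt_id y)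
    have hHg := hH.hasFDerivAt.comp y hg
    have := (HasFDerivAt.finsetProd (u := Finset.univ) fun j _ => hW j).smul hHg
    refine HasFDerivAt.congr_fderiv (f := powTerm α l c H) this ?_
    ext v
    have hsplit : fderiv ℝ H (powGraph α l y)
        (fun i => powDeriv α (l i y) * fderiv ℝ (l i) y v, v)
        = ∑ i, (powDeriv α (l i y) * fderiv ℝ (l i) y v) •
            fderiv ℝ H (powGraph α l y) (Pi.single i 1, 0)
          + fderiv ℝ H (powGraph α l y) (0, v) := by
      have : ((fun i => powDeriv α (l i y) * fderiv ℝ (l i) y v, v) : (J → ℝ) × E)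
          = ∑ i, (powDeriv α (l i y) * fderiv ℝ (l i) y v) •
            ((Pi.single i 1, 0) : (J → ℝ) × E) + (0, v) := by
        refine Prod.ext ?_ ?_
        · ext i
          simp [Prod.fst_sum, Finset.sum_apply, Pi.single_apply]
        · simp [Prod.snd_sum]
      rw [this, map_add, map_sum]
      simp only [map_smul]
    symm
    simp only [_root_.add_apply, _root_.sum_apply, powTerm,
      _root_.smul_apply, hprod, powTermDeriv, ContinuousLinearMap.smulRight_apply,
      ContinuousLinearMap.comp_apply, ContinuousLinearMap.inr_apply,
      ContinuousLinearMap.prod_apply, ContinuousLinearMap.id_apply]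
    change _ = (∏ j, powWeight α (c j) (l j y)) • fderiv ℝ H (powGraph α l y)
        (fun i => powDeriv α (l i y) * fderiv ℝ (l i) y v, v) + _
    rw [hsplit, smul_add, Finset.smul_sum, add_right_comm]
    congr 1
    simp only [Function.comp_apply, Finset.sum_smul,
      ← Finset.sum_add_distrib]
    refine Finset.sum_congr rfl fun j _ => ?_
    have e := powWeight_mul_powDeriv hα (hc j) (hz' j)
    rw [← Finset.mul_prod_erase _ _ (Finset.mem_univ j)]
    simp only [smul_add, smul_smul, smul_eq_mul]
    rw [add_comm]
    have hy : (powGraph α l y).2 = y := rfl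
    rw [hy]
    congr 2
    · change _ * (_ * (α * powShift (c j) ((max (l j y) 0) ^ α))) = _
      linear_combination (-(∏ x ∈ Finset.univ.erase j, powWeight α (c x) (l x y))
        * (fderiv ℝ (l j) y) v) * e
    · ring

theorem locHolder_max_zero_rpow {β : ℝ≥0} (hβ : β ≤ 1) {l : E → ℝ} {y : E}
    (hl : ContDiffAt ℝ 1 l y) : LocHolder β (fun z => (max (l z) 0) ^ (β : ℝ)) y := by
  have h1 : LocHolder 1 l y := locHolder_of_contDiffAt le_rfl hl
  have h2 : LocHolder β (fun t : ℝ => (max t 0) ^ (β : ℝ)) (l y) :=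
    ⟨Set.univ, Filter.univ_mem, 1, holderOnWith_univ.mpr (holderWith_max_zero_rpow hβ)⟩
  have := LocHolder.comp_left one_pos h2 h1
  rwa [mul_one] at this

theorem max_zero_rpow_eq {β : ℝ≥0} (hβ0 : 0 < β) (a t : ℝ) :
    ((max t 0) ^ (β : ℝ)) ^ (a / β) = (max t 0) ^ a := by
  have : (β : ℝ) ≠ 0 := by exact_mod_cast hβ0.ne'
  rw [← Real.rpow_mul (le_max_right _ _), mul_div_cancel₀ _ this]

/-- The weights as continuously differentiable functions of `s = t_+^β` and `t`. -/
noncomputable def powWeightAux (α : ℝ) (β : ℝ≥0) : ℕ → ℝ → ℝ → ℝ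
  | 0, _, t => t
  | 1, _, _ => 1
  | c + 2, s, _ => s ^ ((α - 1 - c) / β)

/-- The function factors as a C¹ map L applied to the β-Hölder map z ↦ ((l_j(z)_+^β)_j, z): every
fractional power t^a that occurs has a ≥ β and equals s^(a/β) with s = t^β and a/β ≥ 1. -/
theorem locHolder_powTerm {α : ℝ} {β : ℝ≥0} (hβ0 : 0 < β) (hβ : β ≤ 1) (hβα : (β : ℝ) ≤ α)
    {l : J → E → ℝ} {c : J → ℕ} {H : (J → ℝ) × E → F} {y : E} (hc : ∀ j, (c j : ℝ) + β ≤ α + 1)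
    (hl : ∀ j, ContDiffAt ℝ 1 (l j) y) (hH : ContDiffAt ℝ 1 H (powGraph α l y)) :
    LocHolder β (powTerm α l c H) y := by
  have hβ0' : (0 : ℝ) < β := by exact_mod_cast hβ0
  have hκ : LocHolder β (fun z => ((fun j => (max (l j z) 0) ^ (β : ℝ)), z) : E → (J → ℝ) × E) y :=
    (LocHolder.pi fun j => locHolder_max_zero_rpow hβ (hl j)).prodMk
      (locHolder_of_contDiffAt hβ contDiffAt_id)
  let L : (J → ℝ) × E → F := fun z => (∏ j, powWeightAux α β (c j) (z.1 j) (l j z.2)) •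
    H (fun j => (z.1 j) ^ (α / β), z.2)
  have hrpow : ∀ a : ℝ, (β : ℝ) ≤ a → ContDiff ℝ 1 fun t : ℝ => t ^ (a / β) := fun a ha =>
    Real.contDiff_rpow_const_of_le (n := 1) (by rw [Nat.cast_one, one_le_div hβ0']; exact ha)
  set z₀ : (J → ℝ) × E := (fun j => (max (l j y) 0) ^ (β : ℝ), y) with hz₀
  have hfst : ∀ j, ContDiffAt ℝ 1 (fun z : (J → ℝ) × E => z.1 j) z₀ := fun j =>
    ((contDiff_apply ℝ ℝ j).comp contDiff_fst).contDiffAt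
  have hlj : ∀ j, ContDiffAt ℝ 1 (fun z : (J → ℝ) × E => l j z.2) z₀ := fun j =>
    (hl j).comp z₀ contDiffAt_snd
  have hL : ContDiffAt ℝ 1 L z₀ := by
    refine ContDiffAt.smul (contDiffAt_prod fun j _ => ?_) ?_
    · have hcj := hc j
      rcases hj : c j with _ | _ | c'
      · exact hlj j
      · exact contDiffAt_const
      · rw [hj] at hcj
        push_cast at hcj
        exact (hrpow (α - 1 - c') (by linarith)).contDiffAt.comp z₀ (hfst j)
    · refine ContDiffAt.comp z₀ (g := H) (f := fun z : (J → ℝ) × E =>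
        ((fun j => (z.1 j) ^ (α / β)), z.2)) ?_ ?_
      · convert hH using 1
        simp only [hz₀, powGraph, max_zero_rpow_eq hβ0]
      · exact (contDiffAt_pi.mpr fun j =>
          (hrpow α hβα).contDiffAt.comp z₀ (hfst j)).prodMk contDiffAt_snd
  have := LocHolder.comp_left
    (f := fun z => ((fun j => (max (l j z) 0) ^ (β : ℝ), z) : (J → ℝ) × E)) hβ0
    (locHolder_of_contDiffAt (β := 1) le_rfl hL) hκ
  rw [one_mul] at this
  convert this using 1
  ext z
  simp only [Function.comp_apply, L, powTerm, powGraph, max_zero_rpow_eq hβ0]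
  congr 1
  refine Finset.prod_congr rfl fun j _ => ?_
  rcases c j with _ | _ | c'
  · rfl
  · rfl
  · simp only [powWeight, powWeightAux, max_zero_rpow_eq hβ0]

/-- Induction on the order N by `hasFDerivAt_powTerm`. The invariant c j + N ≤ ⌈α⌉ keeps the weights
differentiable while N > 0, and leaves exponents α + 1 - c j ≥ β at N = 0. The target F varies
because differentiation replaces it by `E →L[ℝ] F`. -/
theorem holderNear_powTerm {α : ℝ} (hα : 0 < α) {β : ℝ≥0} (hβ : (β : ℝ) = 1 + α - ⌈α⌉₊)
    {l : J → E → ℝ} {y : E} (hl : ∀ j, ∀ᶠ z in 𝓝 y, ContDiffAt ℝ ∞ (l j) z) (N : ℕ) :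
    ∀ {F : Type} [NormedAddCommGroup F] [NormedSpace ℝ F] (H : (J → ℝ) × E → F) (c : J → ℕ),
      (∀ j, c j + N ≤ ⌈α⌉₊) → (∀ᶠ z in 𝓝 (powGraph α l y), ContDiffAt ℝ ∞ H z) →
      HolderNear N β (powTerm α l c H) y := by
  have h1 : α ≤ ⌈α⌉₊ := Nat.le_ceil α
  have h2 : (⌈α⌉₊ : ℝ) < α + 1 := Nat.ceil_lt_add_one hα.le
  have h3 : (1 : ℝ) ≤ ⌈α⌉₊ := by exact_mod_cast Nat.one_le_iff_ne_zero.mpr (Nat.ceil_pos.mpr hα).ne'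
  have hβ0 : 0 < β := by
    rw [← NNReal.coe_pos, hβ]; linarith
  have hβ1 : β ≤ 1 := by
    rw [← NNReal.coe_le_coe, hβ, NNReal.coe_one]; linarith
  have hG : ContinuousAt (powGraph α l) y :=
    continuousAt_powGraph hα fun j => (hl j).self_of_nhds.continuousAt
  induction N with
  | zero =>
    intro F _ _ H c hc hH
    refine (locHolder_powTerm hβ0 hβ1 (by linarith) (fun j => ?_)
      (fun j => (hl j).self_of_nhds.of_le (by norm_num))
      (hH.self_of_nhds.of_le (by norm_num))).holderNear hβ0
    have : (c j : ℝ) ≤ ⌈α⌉₊ := by exact_mod_cast hc j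
    linarith
  | succ N ih =>
    intro F _ _ H c hc hH
    have hc' : ∀ j, (c j : ℝ) < α := fun j => Nat.lt_ceil.mp (by have := hc j; omega)
    refine HolderNear.of_hasFDerivAt (f' := fun y =>
      ∑ j, powTerm α l (Function.update c j (c j + 1)) (powTermDeriv α l c H j) y
        + powTerm α l c (fun z => (fderiv ℝ H z).comp (ContinuousLinearMap.inr ℝ (J → ℝ) E)) y)
      ?_ ?_
    · filter_upwards [Filter.eventually_all.mpr hl, hG.eventually hH] with z hz hHz
      exact hasFDerivAt_powTerm hα hc' (fun j => (hz j).differentiableAt (by simp))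
        (hHz.differentiableAt (by simp))
    · have hfH : ∀ᶠ z in 𝓝 (powGraph α l y), ContDiffAt ℝ ∞ (fderiv ℝ H) z :=
        hH.mono fun z hz => hz.fderiv_right (by norm_num)
      refine (HolderNear.sum _ fun j _ => ih _ _ (fun i => ?_) ?_).add (ih _ _ (fun i => ?_) ?_)
      · by_cases hij : i = j
        · subst hij
          have := hc i
          simp only [Function.update_self]
          omega
        · have := hc i
          rw [Function.update_of_ne hij]
          omega
      · have hsnd : Filter.Tendsto Prod.snd (𝓝 (powGraph α l y)) (𝓝 y) :=
          (continuous_snd (X := J → ℝ) (Y := E)).tendsto (powGraph α l y)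
        filter_upwards [hH, hfH, hsnd.eventually (hl j)] with z hz hfz hlz
        have hD : ContDiffAt ℝ ∞ (fun z : (J → ℝ) × E => fderiv ℝ (l j) z.2) z :=
          (hlz.fderiv_right (m := ∞) (by norm_num)).comp z contDiffAt_snd
        have hs : ContDiffAt ℝ ∞ (fun z : (J → ℝ) × E => z.1 j) z :=
          ((contDiff_apply ℝ ℝ j).comp contDiff_fst).contDiffAt
        exact hD.smulRight ((contDiffAt_const.smul hz).add
          ((contDiffAt_const.mul ((contDiff_powShift (c j)).contDiffAt.comp z hs)).smul
            (hfz.clm_apply contDiffAt_const)))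
      · have := hc i
        omega
      · filter_upwards [hfH] with z hz
        exact hz.clm_comp contDiffAt_const

end PowerProducts

/-! ### Corner charts, invariance of the boundary, and consequences of a local product form. -/

section Charts

variable {E : Type*} [NormedAddCommGroup E] [NormedSpace ℝ E] {X : Set E} {m k l : ℕ}

theorem exists_cornerChart {O : Set E} {W : Set (EuclideanSpace ℝ (Fin m))}
    {f : E → EuclideanSpace ℝ (Fin m)} {g : EuclideanSpace ℝ (Fin m) → E}
    (hO : IsOpen O) (hW : IsOpen W) (hf : ContDiffOn ℝ ∞ f O) (hg : ContDiffOn ℝ ∞ g W)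
    (hfg : ∀ x ∈ X, x ∈ O → f x ∈ W → f x ∈ cornerModel m k ∧ g (f x) = x)
    (hgf : ∀ y ∈ W, y ∈ cornerModel m k → g y ∈ X ∧ g y ∈ O ∧ f (g y) = y)
    (hX : X.Nonempty) :
    ∃ φ : CornerChart X m k, (∀ x : X, x ∈ φ.toHomeo.source ↔ (x : E) ∈ O ∧ f x ∈ W) ∧
      (∀ y : cornerModel m k, y ∈ φ.toHomeo.target ↔ (y : EuclideanSpace ℝ (Fin m)) ∈ W) ∧
      (∀ x ∈ φ.toHomeo.source, (φ.toHomeo x : EuclideanSpace ℝ (Fin m)) = f x) ∧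
      ∀ y ∈ φ.toHomeo.target, (φ.toHomeo.symm y : E) = g y := by
  classical
  obtain ⟨x₀, hx₀⟩ := hX
  -- The values of `F` and `G` outside the chart are irrelevant; 0, which lies in the model, and
  -- `x₀` serve as defaults.
  let F : X → cornerModel m k := fun x =>
    if h : f x ∈ cornerModel m k then ⟨f x, h⟩ else ⟨0, fun i _ => le_rfl⟩
  let G : cornerModel m k → X := fun y => if h : g y ∈ X then ⟨g y, h⟩ else ⟨x₀, hx₀⟩
  have hF : ∀ x : X, f x ∈ cornerModel m k → (F x : EuclideanSpace ℝ (Fin m)) = f x :=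
    fun x hx => by simp only [F, dif_pos hx]
  have hG : ∀ y : cornerModel m k, g y ∈ X → (G y : E) = g y :=
    fun x hx => by simp only [G, dif_pos hx]
  let S : Set X := {x | (x : E) ∈ O ∧ f x ∈ W}
  let T : Set (cornerModel m k) := {y | (y : EuclideanSpace ℝ (Fin m)) ∈ W}
  have hFS : ∀ x ∈ S, (F x : EuclideanSpace ℝ (Fin m)) = f x := fun x hx =>
    hF x (hfg x x.2 hx.1 hx.2).1
  have hGT : ∀ y ∈ T, (G y : E) = g y := fun y hy => hG y (hgf y hy y.2).1
  let φ : OpenPartialHomeomorph X (cornerModel m k) :=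
    { toFun := F
      invFun := G
      source := S
      target := T
      map_source' := fun x hx => by
        change (F x : EuclideanSpace ℝ (Fin m)) ∈ W
        rw [hFS x hx]; exact hx.2
      map_target' := fun y hy => by
        change (G y : E) ∈ O ∧ f (G y) ∈ W
        rw [hGT y hy, (hgf y hy y.2).2.2]
        exact ⟨(hgf y hy y.2).2.1, hy⟩
      left_inv' := fun x hx => by
        have h := hfg x x.2 hx.1 hx.2
        have hT : F x ∈ T := by
          change (F x : EuclideanSpace ℝ (Fin m)) ∈ W
          rw [hFS x hx]; exact hx.2
        apply Subtype.ext
        rw [hGT _ hT, hFS x hx, h.2]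
      right_inv' := fun y hy => by
        have h := hgf y hy y.2
        have hS : G y ∈ S := by
          change (G y : E) ∈ O ∧ f (G y) ∈ W
          rw [hGT y hy, h.2.2]
          exact ⟨h.2.1, hy⟩
        apply Subtype.ext
        rw [hFS _ hS, hGT y hy, h.2.2]
      open_source := by
        have := (hf.continuousOn.isOpen_inter_preimage hO hW).preimage
          (continuous_subtype_val (p := fun x => x ∈ X))
        exact this
      open_target := hW.preimage continuous_subtype_val
      continuousOn_toFun := by
        rw [Topology.IsInducing.subtypeVal.continuousOn_iff]
        refine ContinuousOn.congr (f := fun x : X => f x) ?_ hFS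
        exact hf.continuousOn.comp continuous_subtype_val.continuousOn fun x hx => hx.1
      continuousOn_invFun := by
        rw [Topology.IsInducing.subtypeVal.continuousOn_iff]
        refine ContinuousOn.congr (f := fun y : cornerModel m k => g y) ?_ hGT
        exact hg.continuousOn.comp continuous_subtype_val.continuousOn fun x hx => hx }
  exact ⟨⟨φ, fun x hx => ⟨O, hO, hx.1, f, hf, fun y hy _ => hFS y hy⟩,
      fun y hy => ⟨W, hW, hy, g, hg, fun z hz _ => hGT z hz⟩⟩,
    fun x => Iff.rfl, fun y => Iff.rfl, hFS, hGT⟩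

theorem CornerChart.exists_smooth_transition (ψ : CornerChart X m l) (φ : CornerChart X m k)
    {x : cornerModel m l} (hx : x ∈ ψ.toHomeo.target)
    (hx' : ψ.toHomeo.symm x ∈ φ.toHomeo.source) :
    ∃ W : Set (EuclideanSpace ℝ (Fin m)), IsOpen W ∧ (x : EuclideanSpace ℝ (Fin m)) ∈ W ∧
      ∃ g : EuclideanSpace ℝ (Fin m) → EuclideanSpace ℝ (Fin m), ContDiffOn ℝ ∞ g W ∧
        ∀ y ∈ ψ.toHomeo.target, (y : EuclideanSpace ℝ (Fin m)) ∈ W →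
          ψ.toHomeo.symm y ∈ φ.toHomeo.source ∧
            (φ.toHomeo (ψ.toHomeo.symm y) : EuclideanSpace ℝ (Fin m)) = g y := by
  obtain ⟨W, hW, hxW, g, hg, hgy⟩ := ψ.compatible φ x ⟨hx, hx'⟩
  have ho : IsOpen (ψ.toHomeo.target ∩ ψ.toHomeo.symm ⁻¹' φ.toHomeo.source) :=
    ψ.toHomeo.symm.isOpen_inter_preimage φ.toHomeo.open_source
  obtain ⟨U, hU, hUeq⟩ := isOpen_induced_iff.mp ho
  have hmem : ∀ y : cornerModel m l, (y : EuclideanSpace ℝ (Fin m)) ∈ U ↔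
      y ∈ ψ.toHomeo.target ∩ ψ.toHomeo.symm ⁻¹' φ.toHomeo.source := fun y => by
    rw [← hUeq]; rfl
  refine ⟨W ∩ U, hW.inter hU, ⟨hxW, (hmem x).mpr ⟨hx, hx'⟩⟩, g,
    hg.mono Set.inter_subset_left, fun y hy hyW => ?_⟩
  have := (hmem y).mp hyW.2
  exact ⟨this.2, hgy y this hyW.1⟩

/-- A chart without boundary coordinates has a target that is open in ℝ^m, so the transition a to
another chart has an invertible derivative at p. If a boundary coordinate of the other chart
vanished at p, that component of a would have a local minimum there, and its derivative would be
zero. -/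
theorem CornerChart.notMem_depthStratum_one (φ : CornerChart X m 0) {p : X}
    (hp : p ∈ φ.toHomeo.source) : p ∉ depthStratum m X 1 := by
  rintro ⟨l, hl, ψ, hpψ, hcard⟩
  obtain ⟨i, hi⟩ := Set.ncard_eq_one.mp hcard
  have hi' : (i : ℕ) < l ∧ (ψ.toHomeo p : EuclideanSpace ℝ (Fin m)) i = 0 := by
    have : i ∈ ({i} : Set (Fin m)) := rfl
    rw [← hi] at this
    exact this
  set y := φ.toHomeo p with hy
  have hyt : y ∈ φ.toHomeo.target := φ.toHomeo.map_source hp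
  have hyp : φ.toHomeo.symm y = p := φ.toHomeo.left_inv hp
  set z := ψ.toHomeo p with hz
  have hzt : z ∈ ψ.toHomeo.target := ψ.toHomeo.map_source hpψ
  have hzp : ψ.toHomeo.symm z = p := ψ.toHomeo.left_inv hpψ
  obtain ⟨W, hW, hyW, a, ha, hay⟩ := φ.exists_smooth_transition ψ hyt (by rw [hyp]; exact hpψ)
  obtain ⟨V, hV, hzV, b, hb, hbz⟩ := ψ.exists_smooth_transition φ hzt (by rw [hzp]; exact hp)
  obtain ⟨U, hU, hUeq⟩ := isOpen_induced_iff.mp φ.toHomeo.open_target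
  have hmodel : ∀ w : EuclideanSpace ℝ (Fin m), w ∈ cornerModel m 0 := fun w i h =>
    absurd h (Nat.not_lt_zero _)
  have hyU : (y : EuclideanSpace ℝ (Fin m)) ∈ U := by rw [← hUeq] at hyt; exact hyt
  have hUt : ∀ w (_ : w ∈ U), (⟨w, hmodel w⟩ : cornerModel m 0) ∈ φ.toHomeo.target := by
    intro w hw; rw [← hUeq]; exact hw
  have hay0 : a y = z := by rw [← (hay y hyt hyW).2, hyp]
  have hac : ContDiffAt ℝ ∞ a y := ha.contDiffAt (hW.mem_nhds hyW)
  have hbc : ContDiffAt ℝ ∞ b (a y) := by rw [hay0]; exact hb.contDiffAt (hV.mem_nhds hzV)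
  have had := (hac.differentiableAt (by simp)).hasFDerivAt
  have hbd := (hbc.differentiableAt (by simp)).hasFDerivAt
  have hnear : ∀ᶠ w in 𝓝 (y : EuclideanSpace ℝ (Fin m)), w ∈ W ∧ w ∈ U ∧ a w ∈ V := by
    have hVa : V ∈ 𝓝 (a y) := hV.mem_nhds (by rw [hay0]; exact hzV)
    filter_upwards [hW.mem_nhds hyW, hU.mem_nhds hyU, hac.continuousAt hVa] with w h1 h2 h3
    exact ⟨h1, h2, h3⟩
  have hid : ∀ᶠ w in 𝓝 (y : EuclideanSpace ℝ (Fin m)), (b ∘ a) w = w := by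
    filter_upwards [hnear] with w ⟨h1, h2, h3⟩
    obtain ⟨h4, h5⟩ := hay _ (hUt w h2) h1
    rw [Function.comp_apply, ← h5]
    rw [← h5] at h3
    rw [← (hbz _ (ψ.toHomeo.map_source h4) h3).2, ψ.toHomeo.left_inv h4,
      φ.toHomeo.right_inv (hUt w h2)]
  have hcomp : (fderiv ℝ b (a y)).comp (fderiv ℝ a y) = ContinuousLinearMap.id ℝ _ :=
    ((hbd.comp _ had).congr_of_eventuallyEq (hid.mono fun w hw => hw.symm)).unique (hasFDerivAt_id _)
  have hinj : Function.Injective (fderiv ℝ a y) := fun u v huv => by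
    have h := congrArg (fderiv ℝ b (a y)) huv
    rw [← ContinuousLinearMap.comp_apply, ← ContinuousLinearMap.comp_apply, hcomp] at h
    exact h
  have hsurj : Function.Surjective (fderiv ℝ a y) :=
    (LinearMap.injective_iff_surjective
      (f := (fderiv ℝ a y : EuclideanSpace ℝ (Fin m) →ₗ[ℝ] EuclideanSpace ℝ (Fin m)))).mp hinj
  have hmin : IsLocalMin (fun w => a w i) (y : EuclideanSpace ℝ (Fin m)) := by
    filter_upwards [hnear] with w ⟨h1, h2, h3⟩
    rw [hay0, hi'.2, ← (hay _ (hUt w h2) h1).2]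
    exact (ψ.toHomeo _).2 i hi'.1
  have hproj : HasFDerivAt (fun w => a w i)
      ((EuclideanSpace.proj i : EuclideanSpace ℝ (Fin m) →L[ℝ] ℝ).comp (fderiv ℝ a y))
      (y : EuclideanSpace ℝ (Fin m)) :=
    (EuclideanSpace.proj i : EuclideanSpace ℝ (Fin m) →L[ℝ] ℝ).hasFDerivAt.comp _ had
  have h0 := hmin.hasFDerivAt_eq_zero hproj
  obtain ⟨u, hu⟩ := hsurj (EuclideanSpace.single i 1)
  have := congrArg (fun L => L u) h0
  simp [hu] at this

/-- Around each point of `X` there is a corner chart, centred at that point in the boundary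
coordinates, in which the points of `I` are those with positive boundary coordinates, and in which
`R` on `I` is the product of the boundary coordinates `y_i` with a positive smooth function
of the `y_i^α` and of `y`. -/
def HasCornerForm (m : ℕ) (I : Set X) (α : ℝ) (R : X → ℝ) : Prop :=
  ∀ p : X, ∃ (k : ℕ) (hk : k ≤ m) (φ : CornerChart X m k), p ∈ φ.toHomeo.source ∧
    (∀ i : Fin m, (i : ℕ) < k → (φ.toHomeo p : EuclideanSpace ℝ (Fin m)) i = 0) ∧
    (∀ y ∈ φ.toHomeo.target, φ.toHomeo.symm y ∈ I ↔
      ∀ i : Fin m, (i : ℕ) < k → 0 < (y : EuclideanSpace ℝ (Fin m)) i) ∧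
    ∃ H : (Fin k → ℝ) × EuclideanSpace ℝ (Fin m) → ℝ,
      (∀ᶠ z in 𝓝 ((0, φ.toHomeo p) : (Fin k → ℝ) × EuclideanSpace ℝ (Fin m)),
        ContDiffAt ℝ ∞ H z) ∧ 0 < H (0, φ.toHomeo p) ∧
      ∀ᶠ y in 𝓝 (φ.toHomeo p : EuclideanSpace ℝ (Fin m)), ∀ hy : y ∈ cornerModel m k,
        ⟨y, hy⟩ ∈ φ.toHomeo.target → φ.toHomeo.symm ⟨y, hy⟩ ∈ I →
          R (φ.toHomeo.symm ⟨y, hy⟩) =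
            (∏ i : Fin k, y (Fin.castLE hk i)) * H (fun i => y (Fin.castLE hk i) ^ α, y)

variable {I : Set X} {α : ℝ} {R : X → ℝ}

theorem HasCornerForm.isManifoldWithCorners (h : HasCornerForm m I α R) :
    IsManifoldWithCorners m X := fun p => by
  obtain ⟨k, hk, φ, hp, -⟩ := h p
  exact ⟨k, hk, φ, hp⟩

/-- As the chart is centred at p, membership of p in I means k = 0, and then a whole neighbourhood
avoids the depth-one stratum. If k > 0, depth-one points accumulate at p. -/
theorem HasCornerForm.notMem_cornerBoundary_iff (h : HasCornerForm m I α R) (p : X) :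
    p ∉ cornerBoundary m X ↔ p ∈ I := by
  obtain ⟨k, hk, φ, hp, hp0, hI, -⟩ := h p
  have hpt := φ.toHomeo.map_source hp
  have hpI := hI _ hpt
  rw [φ.toHomeo.left_inv hp] at hpI
  constructor
  · intro hb
    by_contra hpn
    apply hb
    have hk0 : 0 < k := by
      by_contra hk0
      exact hpn (hpI.mpr fun i hi => absurd hi (by omega))
    have hm : 0 < m := hk0.trans_le hk
    let i₀ : Fin m := ⟨0, hm⟩
    -- Moving along `d` makes every boundary coordinate but the one at `i₀` positive, so depth is
    -- exactly one; the factor |ε| keeps the points in the model for both signs of ε.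
    let d : EuclideanSpace ℝ (Fin m) := WithLp.toLp 2 fun i => if (i : ℕ) < k ∧ i ≠ i₀ then 1 else 0
    let y : ℝ → EuclideanSpace ℝ (Fin m) := fun ε => φ.toHomeo p + |ε| • d
    have hyi : ∀ ε i, y ε i = (φ.toHomeo p : EuclideanSpace ℝ (Fin m)) i
        + |ε| * (if (i : ℕ) < k ∧ i ≠ i₀ then 1 else 0) := fun ε i => by simp [y, d]
    have hyc : ∀ ε, y ε ∈ cornerModel m k := fun ε i hi => by
      rw [hyi, hp0 i hi, zero_add]
      split_ifs <;> simp
    let Y : ℝ → cornerModel m k := fun ε => ⟨y ε, hyc ε⟩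
    have hY : Continuous Y := by
      refine Continuous.subtype_mk ?_ _
      fun_prop
    have hY0 : Y 0 = φ.toHomeo p := by
      apply Subtype.ext
      simp [Y, y]
    have hYt : ∀ᶠ ε in 𝓝 (0 : ℝ), Y ε ∈ φ.toHomeo.target :=
      hY.continuousAt (φ.toHomeo.open_target.mem_nhds (by rw [hY0]; exact hpt))
    have hlim : Filter.Tendsto (fun ε => φ.toHomeo.symm (Y ε)) (𝓝[≠] 0) (𝓝 p) := by
      have hc : ContinuousAt φ.toHomeo.symm (Y 0) := by
        rw [hY0]; exact φ.toHomeo.continuousAt_symm hpt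
      have := (hc.comp hY.continuousAt).tendsto
      simp only [Function.comp_apply, hY0, φ.toHomeo.left_inv hp] at this
      exact this.mono_left nhdsWithin_le_nhds
    refine mem_closure_of_tendsto hlim ?_
    filter_upwards [self_mem_nhdsWithin, hYt.filter_mono nhdsWithin_le_nhds] with ε hε hεt
    refine ⟨k, hk, φ, φ.toHomeo.map_target hεt, ?_⟩
    rw [φ.toHomeo.right_inv hεt, Set.ncard_eq_one]
    refine ⟨i₀, Set.ext fun i => ?_⟩
    change ((i : ℕ) < k ∧ y ε i = 0) ↔ i = i₀
    constructor
    · rintro ⟨hi, h0⟩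
      by_contra hne
      rw [hyi, hp0 i hi, if_pos ⟨hi, hne⟩] at h0
      simp at h0
      exact hε h0
    · rintro rfl
      refine ⟨hk0, ?_⟩
      rw [hyi, hp0 _ hk0]
      simp
  · intro hpI'
    have hk0 : k = 0 := by
      by_contra hk0
      have hk0 : 0 < k := Nat.pos_of_ne_zero hk0
      have h1 := hpI.mp hpI' ⟨0, hk0.trans_le hk⟩ hk0
      rw [hp0 _ hk0] at h1
      exact lt_irrefl _ h1
    subst hk0
    intro hb
    obtain ⟨q, hq, hq'⟩ := mem_closure_iff.mp hb _ φ.toHomeo.open_source hp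
    exact φ.notMem_depthStratum_one hq hq'

/-- Off I both sides vanish, R by assumption and the product because some boundary coordinate is
zero. So the product formula holds up to the boundary. -/
theorem HasCornerForm.exists_local_form (h : HasCornerForm m I α R)
    (h0 : ∀ p, p ∉ I → R p = 0) (p : X) :
    ∃ (k : ℕ) (hk : k ≤ m) (φ : CornerChart X m k), p ∈ φ.toHomeo.source ∧
      (∀ i : Fin m, (i : ℕ) < k → (φ.toHomeo p : EuclideanSpace ℝ (Fin m)) i = 0) ∧
      ∃ H : (Fin k → ℝ) × EuclideanSpace ℝ (Fin m) → ℝ,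
        (∀ᶠ z in 𝓝 ((0, φ.toHomeo p) : (Fin k → ℝ) × EuclideanSpace ℝ (Fin m)),
          ContDiffAt ℝ ∞ H z) ∧ 0 < H (0, φ.toHomeo p) ∧
        ∀ᶠ y in 𝓝 (φ.toHomeo p : EuclideanSpace ℝ (Fin m)), ∀ q ∈ φ.toHomeo.source,
          (φ.toHomeo q : EuclideanSpace ℝ (Fin m)) = y →
            R q = (∏ i : Fin k, y (Fin.castLE hk i)) * H (fun i => y (Fin.castLE hk i) ^ α, y) := by
  obtain ⟨k, hk, φ, hp, hp0, hI, H, hH, hHpos, hform⟩ := h p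
  refine ⟨k, hk, φ, hp, hp0, H, hH, hHpos, ?_⟩
  filter_upwards [hform] with y hy q hq hqy
  have hyc : y ∈ cornerModel m k := by rw [← hqy]; exact (φ.toHomeo q).2
  have hqy' : φ.toHomeo q = ⟨y, hyc⟩ := Subtype.ext hqy
  have hsymm : φ.toHomeo.symm ⟨y, hyc⟩ = q := by rw [← hqy', φ.toHomeo.left_inv hq]
  have ht : (⟨y, hyc⟩ : cornerModel m k) ∈ φ.toHomeo.target := by
    rw [← hqy']; exact φ.toHomeo.map_source hq
  by_cases hqI : q ∈ I
  · have := hy hyc ht (by rwa [hsymm])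
    rwa [hsymm] at this
  · rw [h0 q hqI]
    have := (hI _ ht).not.mp (by rwa [hsymm])
    push Not at this
    obtain ⟨i, hi, hi0⟩ := this
    have hyi : y i = 0 := le_antisymm hi0 (hyc i hi)
    rw [Finset.prod_eq_zero (Finset.mem_univ (⟨i, hi⟩ : Fin k)) (by simpa using hyi), zero_mul]

theorem HasCornerForm.isHolderOnCorners (h : HasCornerForm m I α R) (hα : 0 < α)
    (h0 : ∀ p, p ∉ I → R p = 0) : IsHolderOnCorners (1 + α) m R := by
  intro l hl ψ x hx
  obtain ⟨k, hk, φ, hp, hp0, H, hH, -, hform⟩ := h.exists_local_form h0 (ψ.toHomeo.symm x)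
  obtain ⟨W, hW, hxW, g, hg, hgy⟩ := ψ.exists_smooth_transition φ hx hp
  have hgx := (hgy x hx hxW).2
  rw [hgx] at hp0 hH hform
  have hgc : ∀ᶠ z in 𝓝 (x : EuclideanSpace ℝ (Fin m)), ContDiffAt ℝ ∞ g z := by
    filter_upwards [hW.mem_nhds hxW] with z hz
    exact hg.contDiffAt (hW.mem_nhds hz)
  have hgcont : ContinuousAt g x := hgc.self_of_nhds.continuousAt
  have hceil : ⌈1 + α⌉₊ - 1 = ⌈α⌉₊ := by
    rw [add_comm, Nat.ceil_add_one hα.le, Nat.add_sub_cancel]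
  rw [hceil]
  have hβ : ((1 + α - (⌈α⌉₊ : ℝ)).toNNReal : ℝ) = 1 + α - ⌈α⌉₊ :=
    Real.coe_toNNReal _ (by linarith [Nat.ceil_lt_add_one hα.le])
  -- In an arbitrary chart ψ the boundary coordinates of φ become components of a smooth extension g
  -- of the transition map. These may be negative off the corner, which is why the powers are taken
  -- of positive parts.
  let L : Fin k → EuclideanSpace ℝ (Fin m) → ℝ := fun j y => g y (Fin.castLE hk j)
  have hgraph : powGraph α L (x : EuclideanSpace ℝ (Fin m)) = (0, (x : EuclideanSpace ℝ (Fin m))) := by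
    refine Prod.ext (funext fun j => ?_) rfl
    simp only [powGraph, L, hp0 (Fin.castLE hk j) j.2, max_self, Real.zero_rpow hα.ne']
    rfl
  obtain ⟨V, hV, hxV, hc, K, hK⟩ := holderNear_powTerm hα hβ (l := L)
    (y := (x : EuclideanSpace ℝ (Fin m)))
    (fun j => hgc.mono fun z hz =>
      (EuclideanSpace.proj (𝕜 := ℝ) (Fin.castLE hk j)).contDiff.contDiffAt.comp z hz) ⌈α⌉₊
    (fun z : (Fin k → ℝ) × EuclideanSpace ℝ (Fin m) => H (z.1, g z.2)) (fun _ => 0)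
    (fun j => by simp) (by
      rw [hgraph]
      have ht : Filter.Tendsto
          (fun z : (Fin k → ℝ) × EuclideanSpace ℝ (Fin m) => (z.1, g z.2))
          (𝓝 (0, (x : EuclideanSpace ℝ (Fin m)))) (𝓝 (0, g x)) :=
        (continuousAt_fst.prodMk (hgcont.comp_of_eq continuousAt_snd rfl)).tendsto
      have hs : Filter.Tendsto Prod.snd (𝓝 ((0, x) : (Fin k → ℝ) × EuclideanSpace ℝ (Fin m)))
          (𝓝 (x : EuclideanSpace ℝ (Fin m))) := continuousAt_snd
      filter_upwards [ht.eventually hH, hs.eventually hgc] with z hz hgz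
      exact ContDiffAt.comp z (g := H) hz (contDiffAt_fst.prodMk (hgz.comp z contDiffAt_snd)))
  obtain ⟨U, hUf, hU, hxU⟩ := eventually_nhds_iff.mp (hgcont.eventually hform)
  refine ⟨V ∩ (W ∩ U), hV.inter (hW.inter hU), ⟨hxV, hxW, hxU⟩, _,
    hc.mono Set.inter_subset_left, ⟨K, hK.mono Set.inter_subset_left⟩, ?_⟩
  rintro y hy ⟨-, hyW, hyU⟩
  obtain ⟨hsrc, hgy'⟩ := hgy y hy hyW
  beta_reduce
  rw [hUf _ hyU _ hsrc hgy']
  have hnn : ∀ j : Fin k, 0 ≤ g y (Fin.castLE hk j) := fun j => by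
    rw [← hgy']; exact (φ.toHomeo _).2 _ j.2
  simp only [powTerm, powWeight, powGraph, L, max_eq_left (hnn _), smul_eq_mul]

theorem HasCornerForm.isBoundaryDefiningFunction (h : HasCornerForm m I 1 R)
    (h0 : ∀ p, p ∉ I → R p = 0) (hpos : ∀ p ∈ I, 0 < R p) : IsBoundaryDefiningFunction m R := by
  refine ⟨?_, fun p hp => h0 p fun hpI => (h.notMem_cornerBoundary_iff p).mpr hpI hp,
    fun p hp => hpos p ((h.notMem_cornerBoundary_iff p).mp hp), fun p => ?_⟩
  · intro l hl ψ x hx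
    obtain ⟨k, hk, φ, hp, hp0, H, hH, -, hform⟩ :=
      h.exists_local_form h0 (ψ.toHomeo.symm x)
    obtain ⟨W, hW, hxW, g, hg, hgy⟩ := ψ.exists_smooth_transition φ hx hp
    have hgx := (hgy x hx hxW).2
    rw [hgx] at hp0 hH hform
    have hgc : ContinuousAt g x := (hg.contDiffAt (hW.mem_nhds hxW)).continuousAt
    let s : EuclideanSpace ℝ (Fin m) → (Fin k → ℝ) × EuclideanSpace ℝ (Fin m) :=
      fun y => (fun j => y (Fin.castLE hk j), y)
    have hs : ContDiff ℝ ∞ s := by fun_prop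
    have hs0 : s (g x) = (0, g x) := Prod.ext (funext fun j => hp0 _ j.2) rfl
    have hH' : ∀ᶠ y in 𝓝 (x : EuclideanSpace ℝ (Fin m)), ContDiffAt ℝ ∞ H (s (g y)) :=
      hgc.eventually (hs.continuous.continuousAt.eventually (by rw [hs0]; exact hH))
    obtain ⟨U, hUf, hU, hxU⟩ := eventually_nhds_iff.mp ((hgc.eventually hform).and hH')
    refine ⟨W ∩ U, hW.inter hU, ⟨hxW, hxU⟩,
      fun y => (∏ i : Fin k, g y (Fin.castLE hk i)) * H (s (g y)), ?_, ?_⟩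
    · rintro y ⟨hyW, hyU⟩
      have hgy' := hg.contDiffAt (hW.mem_nhds hyW)
      refine (ContDiffAt.mul (contDiffAt_prod fun j _ => ?_) ?_).contDiffWithinAt
      · exact (EuclideanSpace.proj (𝕜 := ℝ) (Fin.castLE hk j)).contDiff.contDiffAt.comp y hgy'
      · exact ContDiffAt.comp y (g := H) (hUf y hyU).2 (hs.contDiffAt.comp y hgy')
    · rintro y hy ⟨hyW, hyU⟩
      obtain ⟨hsrc, hgy'⟩ := hgy y hy hyW
      beta_reduce
      rw [(hUf _ hyU).1 _ hsrc hgy']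
      simp only [Real.rpow_one, s]
  · obtain ⟨k, hk, φ, hp, hp0, H, hH, hHpos, hform⟩ := h.exists_local_form h0 p
    let s : EuclideanSpace ℝ (Fin m) → (Fin k → ℝ) × EuclideanSpace ℝ (Fin m) :=
      fun y => (fun j => y (Fin.castLE hk j), y)
    have hs : ContDiff ℝ ∞ s := by fun_prop
    have hs0 : s (φ.toHomeo p) = (0, (φ.toHomeo p : EuclideanSpace ℝ (Fin m))) :=
      Prod.ext (funext fun j => hp0 _ j.2) rfl
    have hH' : ∀ᶠ y in 𝓝 (φ.toHomeo p : EuclideanSpace ℝ (Fin m)), ContDiffAt ℝ ∞ H (s y) :=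
      hs.continuous.continuousAt.eventually (by rw [hs0]; exact hH)
    obtain ⟨U, hUf, hU, hxU⟩ := eventually_nhds_iff.mp (hform.and hH')
    refine ⟨k, hk, φ, hp, hp0, U, hU, hxU, fun y => H (s y), ?_, ?_, ?_⟩
    · exact fun y hy => (ContDiffAt.comp y (g := H) (hUf y hy).2 hs.contDiffAt).contDiffWithinAt
    · simp only [hs0, hHpos]
    · intro y hy hyU
      rw [(hUf _ hyU).1 _ (φ.toHomeo.map_target hy) (by rw [φ.toHomeo.right_inv hy]), mul_comm]
      simp only [Real.rpow_one, s]
      congr 1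
      refine Finset.prod_bij (fun j _ => Fin.castLE hk j) (fun j _ => by simp)
        (fun i _ j _ hij => Fin.castLE_injective hk hij) (fun i hi => ?_) (fun _ _ => rfl)
      exact ⟨⟨i, (Finset.mem_filter.mp hi).2⟩, Finset.mem_univ _, rfl⟩

end Charts

/-! ### The mass inner product, partitions and the cluster projections. -/

section LinearAlgebra

variable {n d : ℕ} {m : Fin n → ℝ}

theorem massInner_comm (q q' : Config n d) : massInner m q q' = massInner m q' q := by
  simp only [massInner, real_inner_comm]

theorem massInner_add_left (p q q' : Config n d) :
    massInner m (p + q) q' = massInner m p q' + massInner m q q' := by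
  simp only [massInner, Pi.add_apply, inner_add_left, mul_add, Finset.sum_add_distrib]

theorem massInner_smul_left (a : ℝ) (q q' : Config n d) :
    massInner m (a • q) q' = a * massInner m q q' := by
  simp only [massInner, Pi.smul_apply, real_inner_smul_left, Finset.mul_sum]
  exact Finset.sum_congr rfl fun i _ => by ring

variable (m) in
/-- The mass inner product with a fixed second argument, as a linear map. -/
noncomputable def massInnerL (q' : Config n d) : Config n d →ₗ[ℝ] ℝ where
  toFun q := massInner m q q'
  map_add' p q := massInner_add_left p q q'
  map_smul' a q := massInner_smul_left a q q'

theorem massInner_sub_left (p q q' : Config n d) :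
    massInner m (p - q) q' = massInner m p q' - massInner m q q' :=
  map_sub (massInnerL m q') p q

theorem massInner_zero_left (q' : Config n d) : massInner m 0 q' = 0 :=
  map_zero (massInnerL m q')

theorem massInner_sum_left {ι : Type*} (s : Finset ι) (f : ι → Config n d) (q' : Config n d) :
    massInner m (∑ i ∈ s, f i) q' = ∑ i ∈ s, massInner m (f i) q' :=
  map_sum (massInnerL m q') f s

theorem eq_of_massInner_eq (hm : ∀ i, 0 < m i) {p q : Config n d}
    (h : ∀ x, massInner m p x = massInner m q x) : p = q := by
  by_contra hne
  have := massInner_self_pos m hm (p - q) (sub_ne_zero.mpr hne)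
  rw [massInner_sub_left, h, sub_self] at this
  exact lt_irrefl _ this

theorem part_eq_of_le {C D : Clusters n} (h : C ≤ D) {i j : Fin n} (hij : C.part i = C.part j) :
    D.part i = D.part j := by
  obtain ⟨P, hP, hCP⟩ := h (C.part_mem.mpr (Finset.mem_univ i))
  have hi : i ∈ P := hCP (C.mem_part (Finset.mem_univ i))
  have hj : j ∈ P := hCP (by rw [hij]; exact C.mem_part (Finset.mem_univ j))
  rw [D.part_eq_of_mem hP hi, D.part_eq_of_mem hP hj]

theorem le_of_part_eq {C D : Clusters n}
    (h : ∀ i j, C.part i = C.part j → D.part i = D.part j) : C ≤ D := by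
  intro P hP
  obtain ⟨i, hi⟩ := C.nonempty_of_mem_parts hP
  refine ⟨D.part i, D.part_mem.mpr (Finset.mem_univ i), fun j hj => ?_⟩
  rw [h i j (by rw [C.part_eq_of_mem hP hi, C.part_eq_of_mem hP hj])]
  exact D.mem_part (Finset.mem_univ j)

theorem part_bot_injective : Function.Injective (⊥ : Clusters n).part := by
  intro i j hij
  have h : (⊥ : Clusters n).part j ∈ (⊥ : Clusters n).parts :=
    Finpartition.part_mem _ |>.mpr (Finset.mem_univ j)
  rw [Finpartition.mem_bot_iff] at h
  obtain ⟨a, -, ha⟩ := h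
  have hi := (⊥ : Clusters n).mem_part (Finset.mem_univ i)
  have hj := (⊥ : Clusters n).mem_part (Finset.mem_univ j)
  rw [hij, ← ha, Finset.mem_singleton] at hi
  rw [← ha, Finset.mem_singleton] at hj
  rw [hi, hj]

/-- The partition into the level sets of a function. -/
noncomputable def kerPart {β : Type*} (f : Fin n → β) : Clusters n :=
  haveI := Classical.decRel (Setoid.ker f)
  Finpartition.ofSetoid (Setoid.ker f)

theorem kerPart_part_eq_iff {β : Type*} (f : Fin n → β) {i j : Fin n} :
    (kerPart f).part i = (kerPart f).part j ↔ f i = f j := by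
  let := Classical.decRel (Setoid.ker f)
  have h : i ∈ (kerPart f).part j ↔ f j = f i :=
    Finpartition.mem_part_ofSetoid_iff_rel (s := Setoid.ker f)
  rw [eq_comm (a := f i), ← h]
  constructor
  · intro hij
    rw [← hij]
    exact (kerPart f).mem_part (Finset.mem_univ i)
  · intro hi
    exact (kerPart f).part_eq_of_mem ((kerPart f).part_mem.mpr (Finset.mem_univ j)) hi

theorem projE_const {C : Clusters n} {i j : Fin n} (h : C.part i = C.part j) (q : Config n d) :
    projE m C q i = projE m C q j := by
  simp only [projE, h]

theorem sum_part_pos (hm : ∀ i, 0 < m i) (C : Clusters n) (i : Fin n) :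
    0 < ∑ j ∈ C.part i, m j :=
  Finset.sum_pos (fun j _ => hm j) ⟨i, C.mem_part (Finset.mem_univ i)⟩

theorem projE_eq_self_iff (hm : ∀ i, 0 < m i) {C : Clusters n} {q : Config n d} :
    projE m C q = q ↔ ∀ i j, C.part i = C.part j → q i = q j := by
  constructor
  · intro h i j hij
    rw [← h]
    exact projE_const hij q
  · intro h
    funext i
    have : ∀ j ∈ C.part i, m j • q j = m j • q i := fun j hj => by
      rw [h j i (C.part_eq_of_mem (C.part_mem.mpr (Finset.mem_univ i)) hj)]
    rw [projE, Finset.sum_congr rfl this, ← Finset.sum_smul, smul_smul,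
      inv_mul_cancel₀ (sum_part_pos hm C i).ne', one_smul]

variable (m) in
/-- The projection to the collision subspace, as a linear map. -/
noncomputable def projEL (C : Clusters n) : Config n d →ₗ[ℝ] Config n d where
  toFun := projE m C
  map_add' p q := by
    funext i
    simp [projE, Finset.sum_add_distrib]
  map_smul' a q := by
    funext i
    simp only [projE, Pi.smul_apply, RingHom.id_apply, smul_comm _ a, ← Finset.smul_sum]

theorem projE_add (C : Clusters n) (p q : Config n d) :
    projE m C (p + q) = projE m C p + projE m C q := map_add (projEL m C) p q

theorem projE_sub (C : Clusters n) (p q : Config n d) :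
    projE m C (p - q) = projE m C p - projE m C q := map_sub (projEL m C) p q

theorem projE_smul (C : Clusters n) (a : ℝ) (q : Config n d) :
    projE m C (a • q) = a • projE m C q := map_smul (projEL m C) a q

theorem projE_zero (C : Clusters n) : projE m C (0 : Config n d) = 0 := map_zero (projEL m C)

theorem projE_sum {ι : Type*} (C : Clusters n) (s : Finset ι) (f : ι → Config n d) :
    projE m C (∑ i ∈ s, f i) = ∑ i ∈ s, projE m C (f i) := map_sum (projEL m C) f s

theorem projI_smul (C : Clusters n) (a : ℝ) (q : Config n d) :
    projI m C (a • q) = a • projI m C q := by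
  simp only [projI, projE_smul, smul_sub]

theorem projI_add (C : Clusters n) (p q : Config n d) :
    projI m C (p + q) = projI m C p + projI m C q := by
  simp only [projI, projE_add]; abel

theorem projI_eq_zero_iff {C : Clusters n} {q : Config n d} :
    projI m C q = 0 ↔ projE m C q = q := by
  rw [projI, sub_eq_zero, eq_comm]

theorem projE_add_projI (C : Clusters n) (q : Config n d) : projE m C q + projI m C q = q :=
  add_sub_cancel _ _

theorem projE_bot (hm : ∀ i, 0 < m i) (q : Config n d) : projE m ⊥ q = q :=
  (projE_eq_self_iff hm).mpr fun _ _ h => by rw [part_bot_injective h]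

theorem projE_projE_of_le (hm : ∀ i, 0 < m i) {C D : Clusters n} (h : C ≤ D) (q : Config n d) :
    projE m C (projE m D q) = projE m D q :=
  (projE_eq_self_iff hm).mpr fun _ _ hij => projE_const (part_eq_of_le h hij) q

theorem projE_eq_of_le (hm : ∀ i, 0 < m i) {C D : Clusters n} (h : C ≤ D) {q : Config n d}
    (hq : projE m D q = q) : projE m C q = q := by
  rw [← hq, projE_projE_of_le hm h]

theorem massInner_projI_projE (hm : ∀ i, 0 < m i) (C : Clusters n) (p q : Config n d) :
    massInner m (projI m C p) (projE m C q) = 0 := by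
  rw [massInner, sum_clusters C]
  refine Finset.sum_eq_zero fun P hP => ?_
  obtain ⟨i₀, hi₀⟩ := C.nonempty_of_mem_parts hP
  have h : ∀ i ∈ P, m i * inner ℝ (projI m C p i) (projE m C q i)
      = inner ℝ (m i • projI m C p i) (projE m C q i₀) := by
    intro i hi
    rw [projE_const (C := C) (j := i₀)
      (by rw [C.part_eq_of_mem hP hi, C.part_eq_of_mem hP hi₀]), real_inner_smul_left]
  rw [Finset.sum_congr rfl h, ← sum_inner, sum_projI_part m hm C p hP, inner_zero_left]

theorem massInner_projE_left (hm : ∀ i, 0 < m i) (C : Clusters n) (p q : Config n d) :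
    massInner m (projE m C p) q = massInner m p (projE m C q) := by
  have h1 := massInner_projI_projE hm C p q
  have h2 := massInner_projI_projE hm C q p
  rw [projI, massInner_sub_left] at h1 h2
  rw [massInner_comm q, massInner_comm (projE m C q)] at h2
  linarith

/-- The adjoint of `projE_projE_of_le`, the projections being self-adjoint for the mass inner
product. -/
theorem projE_projE_of_ge (hm : ∀ i, 0 < m i) {C D : Clusters n} (h : C ≤ D) (q : Config n d) :
    projE m D (projE m C q) = projE m D q :=
  eq_of_massInner_eq hm fun x => by
    rw [massInner_projE_left hm, massInner_projE_left hm, massInner_projE_left hm,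
      projE_projE_of_le hm h]

theorem projE_eq_zero_of_le (hm : ∀ i, 0 < m i) {C D : Clusters n} (h : C ≤ D) {q : Config n d}
    (hq : projE m C q = 0) : projE m D q = 0 := by
  rw [← projE_projE_of_ge hm h, hq, projE_zero]

theorem mem_comSpace_of_projE_eq_zero (hm : ∀ i, 0 < m i) {C : Clusters n} {q : Config n d}
    (hq : projE m C q = 0) : q ∈ comSpace d m := by
  have := (projI_mem m hm C q).1
  rwa [projI, hq, sub_zero] at this

variable (d m) in
/-- The center of mass configuration space, as a subspace. -/
noncomputable def comSubmodule : Submodule ℝ (Config n d) where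
  carrier := comSpace d m
  add_mem' {p q} hp hq := by
    simp only [comSpace, Set.mem_ofPred_eq] at hp hq ⊢
    simp [Finset.sum_add_distrib, hp, hq]
  zero_mem' := by simp [comSpace]
  smul_mem' a q hq := by
    simp only [comSpace, Set.mem_ofPred_eq] at hq ⊢
    simp only [Pi.smul_apply, smul_comm _ a, ← Finset.smul_sum, hq, smul_zero]

/-- `(ℝ^d)^n` with the Euclidean norm. -/
abbrev EuclideanConfig (n d : ℕ) : Type := PiLp 2 fun _ : Fin n => EuclideanSpace ℝ (Fin d)

/-- Scaling particle i by √(m i) turns the mass inner product into the Euclidean one. M becomes the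
kernel of a surjection onto ℝ^d, of dimension (n - 1) d, and the given orthonormal vectors extend to
a basis of it. The first k coordinates will be the scales of a flag. -/
theorem exists_orthonormal_coordinates (hn : n ≠ 0) (hm : ∀ i, 0 < m i) {k : ℕ}
    {v : ℕ → Config n d} (hv : ∀ i < k, v i ∈ comSpace d m)
    (hvv : ∀ i < k, ∀ j < k, massInner m (v i) (v j) = if i = j then 1 else 0) :
    k ≤ (n - 1) * d ∧ ∃ (L : EuclideanSpace ℝ (Fin ((n - 1) * d)) →ₗ[ℝ] Config n d)
      (P : Config n d →ₗ[ℝ] EuclideanSpace ℝ (Fin ((n - 1) * d))),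
      (∀ y, L y ∈ comSpace d m) ∧ (∀ y, P (L y) = y) ∧ (∀ q ∈ comSpace d m, L (P q) = q) ∧
      ∀ y, ∀ i : Fin ((n - 1) * d), (i : ℕ) < k → massInner m (L y) (v i) = y i := by
  have hs : ∀ i, 0 < √(m i) := fun i => Real.sqrt_pos.mpr (hm i)
  let J : Config n d →ₗ[ℝ] EuclideanConfig n d :=
    { toFun := fun q => WithLp.toLp 2 fun i => √(m i) • q i
      map_add' := fun p q => by ext i; simp
      map_smul' := fun a q => by ext i; simp; ring }
  let K : EuclideanConfig n d →ₗ[ℝ] Config n d :=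
    { toFun := fun x i => (√(m i))⁻¹ • x i
      map_add' := fun p q => by funext i; simp
      map_smul' := fun a q => by funext i; simp [smul_comm a] }
  have hKJ : ∀ q, K (J q) = q := fun q => by
    funext i
    simp [J, K, smul_smul, inv_mul_cancel₀ (hs i).ne']
  have hJK : ∀ x, J (K x) = x := fun x => by
    ext i
    simp [J, K, mul_inv_cancel_left₀ (hs i).ne']
  have hJ : ∀ p q, inner ℝ (J p) (J q) = massInner m p q := fun p q => by
    rw [PiLp.inner_apply]
    refine Finset.sum_congr rfl fun i _ => ?_
    change inner ℝ (√(m i) • p i) (√(m i) • q i) = _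
    rw [real_inner_smul_left, real_inner_smul_right, ← mul_assoc, Real.mul_self_sqrt (hm i).le]
  let f : EuclideanConfig n d →ₗ[ℝ] EuclideanSpace ℝ (Fin d) :=
    { toFun := fun x => ∑ i, m i • K x i
      map_add' := fun p q => by simp [Finset.sum_add_distrib]
      map_smul' := fun a q => by
        simp only [map_smul, Pi.smul_apply, smul_comm _ a, ← Finset.smul_sum, RingHom.id_apply] }
  let S := LinearMap.ker f
  have hS : ∀ x, x ∈ S ↔ K x ∈ comSpace d m := fun x => Iff.rfl
  have hsurj : Function.Surjective f := fun x => by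
    have i₀ : Fin n := ⟨0, Nat.pos_of_ne_zero hn⟩
    refine ⟨J (Pi.single i₀ ((m i₀)⁻¹ • x)), ?_⟩
    change ∑ i, m i • K (J _) i = x
    rw [hKJ, Finset.sum_eq_single i₀]
    · rw [Pi.single_eq_same, smul_smul, mul_inv_cancel₀ (hm i₀).ne', one_smul]
    · intro j _ hj
      rw [Pi.single_eq_of_ne hj, smul_zero]
    · simp
  have hrank : Module.finrank ℝ S = (n - 1) * d := by
    have h1 := f.finrank_range_add_finrank_ker
    rw [LinearMap.range_eq_top.mpr hsurj, finrank_top] at h1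
    have h2 : Module.finrank ℝ (EuclideanConfig n d) = n * d := by
      rw [(WithLp.linearEquiv 2 ℝ (Fin n → EuclideanSpace ℝ (Fin d))).finrank_eq]
      simp [Module.finrank_pi_fintype]
    rw [h2, finrank_euclideanSpace_fin] at h1
    rw [Nat.sub_mul, one_mul]
    exact Nat.eq_sub_of_add_eq' h1
  classical
  -- Only the v i with i < k are known to lie in M; 0 is a default for the others.
  let w : ℕ → S := fun i => if h : v i ∈ comSpace d m then
    ⟨J (v i), (hS _).mpr (by rwa [hKJ])⟩ else 0
  have hw : ∀ i < k, (w i : EuclideanConfig n d) = J (v i) := fun i hi => by simp only [w, dif_pos (hv i hi)]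
  have hww : ∀ i < k, ∀ j < k, inner ℝ (w i) (w j) = if i = j then (1 : ℝ) else 0 := by
    intro i hi j hj
    rw [Submodule.coe_inner, hw i hi, hw j hj, hJ, hvv i hi j hj]
  have hk : k ≤ (n - 1) * d := by
    have ho : Orthonormal ℝ (fun i : Fin k => w i) := by
      rw [orthonormal_iff_ite]
      intro i j
      rw [hww i i.2 j j.2]
      simp [Fin.ext_iff]
    have := ho.linearIndependent.fintype_card_le_finrank
    rwa [Fintype.card_fin, hrank] at this
  refine ⟨hk, ?_⟩
  obtain ⟨b, hb⟩ := Orthonormal.exists_orthonormalBasis_extension_of_card_eq (𝕜 := ℝ)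
    (ι := Fin ((n - 1) * d)) (by rw [hrank, Fintype.card_fin])
    (v := fun i => w i) (s := {i | (i : ℕ) < k}) (by
      rw [orthonormal_iff_ite]
      intro i j
      refine (hww i i.2 j j.2).trans ?_
      simp [Subtype.ext_iff, Fin.ext_iff])
  refine ⟨K ∘ₗ S.subtype ∘ₗ b.repr.symm.toLinearEquiv.toLinearMap,
    (WithLp.linearEquiv 2 ℝ (Fin ((n - 1) * d) → ℝ)).symm.toLinearMap ∘ₗ
      LinearMap.pi fun i => massInnerL m (K (b i)), fun y => ?_, fun y => ?_, fun q hq => ?_,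
    fun y i hi => ?_⟩
  · exact (hS _).mp (b.repr.symm y).2
  · ext i
    change massInner m (K (b.repr.symm y : EuclideanConfig n d)) (K (b i)) = y i
    rw [← hJ, hJK, hJK, ← Submodule.coe_inner, real_inner_comm, ← b.repr_apply_apply]
    simp
  · have hq' : J q ∈ S := (hS _).mpr (by rwa [hKJ])
    have : b.repr ⟨J q, hq'⟩ = WithLp.toLp 2 fun i => massInner m q (K (b i)) := by
      ext i
      rw [b.repr_apply_apply, real_inner_comm, Submodule.coe_inner, ← hJK (b i : EuclideanConfig n d), hJ]
    change K (b.repr.symm (WithLp.toLp 2 fun i => massInner m q (K (b i)))) = q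
    rw [← this, LinearIsometryEquiv.symm_apply_apply, hKJ]
  · change massInner m (K (b.repr.symm y : EuclideanConfig n d)) (v i) = y i
    have e : J (v i) = (b i : EuclideanConfig n d) := by rw [hb i hi, hw i hi]
    rw [← hJ, hJK, e, ← Submodule.coe_inner, real_inner_comm, ← b.repr_apply_apply]
    simp

end LinearAlgebra

/-! ### Flags of partitions and the multiscale parametrization attached to them. -/

section Flags

variable {n d : ℕ}

/-- A chain `D 0 > D 1 > ⋯ > D k = ⊥` of partitions together with a base configuration `base`,
whose coincidences are described by `D 0`, and unit vectors `v l`, centred with respect to `D l`,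
whose coincidences within the clusters of `D l` are described by `D (l + 1)`. -/
structure Flag (d : ℕ) (m : Fin n → ℝ) where
  k : ℕ
  D : ℕ → Clusters n
  v : ℕ → Config n d
  base : Config n d
  base_mem : base ∈ comSpace d m
  antitone : Antitone D
  D_k : D k = ⊥
  projE_base : projE m (D 0) base = base
  projE_v : ∀ l < k, projE m (D l) (v l) = 0
  projE_succ_v : ∀ l < k, projE m (D (l + 1)) (v l) = v l
  massInner_v : ∀ l < k, massInner m (v l) (v l) = 1
  projI_base_ne : ∀ C, ¬ C ≤ D 0 → projI m C base ≠ 0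
  projI_v_ne : ∀ l < k, ∀ C, C ≤ D l → ¬ C ≤ D (l + 1) → projI m C (v l) ≠ 0

namespace Flag

variable {m : Fin n → ℝ} (F : Flag d m)

theorem v_mem (hm : ∀ i, 0 < m i) {l : ℕ} (hl : l < F.k) : F.v l ∈ comSpace d m :=
  mem_comSpace_of_projE_eq_zero hm (F.projE_v l hl)

theorem massInner_v_of_projE (hm : ∀ i, 0 < m i) {l : ℕ} (hl : l < F.k) {q : Config n d}
    (hq : projE m (F.D l) q = q) : massInner m q (F.v l) = 0 := by
  rw [← hq, massInner_projE_left hm, F.projE_v l hl, massInner_comm, massInner_zero_left]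

theorem massInner_projE_succ_v (hm : ∀ i, 0 < m i) {l : ℕ} (hl : l < F.k) (q : Config n d) :
    massInner m (projE m (F.D (l + 1)) q) (F.v l) = massInner m q (F.v l) := by
  rw [massInner_projE_left hm, F.projE_succ_v l hl]

theorem massInner_projE_v (hm : ∀ i, 0 < m i) {l : ℕ} (hl : l < F.k) (q : Config n d) :
    massInner m (projE m (F.D l) q) (F.v l) = 0 := by
  rw [massInner_projE_left hm, F.projE_v l hl, massInner_comm, massInner_zero_left]

/-- For i < j, v i is constant on the clusters of D (i + 1) and so on those of the finer D j, on
which v j is centred. -/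
theorem massInner_v_v (hm : ∀ i, 0 < m i) {i j : ℕ} (hi : i < F.k) (hj : j < F.k) :
    massInner m (F.v i) (F.v j) = if i = j then 1 else 0 := by
  have key : ∀ i j, i < F.k → j < F.k → i < j → massInner m (F.v i) (F.v j) = 0 :=
    fun i j hi hj hij => F.massInner_v_of_projE hm hj
      (projE_eq_of_le hm (F.antitone (Nat.succ_le_of_lt hij)) (F.projE_succ_v i hi))
  rcases lt_trichotomy i j with h | rfl | h
  · rw [if_neg h.ne, key i j hi hj h]
  · rw [if_pos rfl, F.massInner_v i hi]
  · rw [if_neg h.ne', massInner_comm, key j i hj hi h]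

theorem D_ne_bot (hm : ∀ i, 0 < m i) {l : ℕ} (hl : l < F.k) : F.D l ≠ ⊥ := by
  intro h
  have h1 := F.projE_v l hl
  rw [h, projE_bot hm] at h1
  have h2 := F.massInner_v l hl
  rw [h1, massInner_zero_left] at h2
  exact zero_ne_one h2

/-- The scale coordinates. -/
noncomputable def t (l : ℕ) (y : Config n d) : ℝ := massInner m y (F.v l)

/-- The shape at each level. -/
noncomputable def c : ℕ → Config n d → Config n d
  | 0, y => projE m (F.D 0) y
  | l + 1, y => F.v l + (projE m (F.D (l + 1)) y - projE m (F.D l) y) - F.t l y • F.v l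

/-- The configuration seen at the scale of level `l`. -/
noncomputable def A (l : ℕ) (y : Config n d) : Config n d :=
  ∑ j ∈ Finset.Ico l (F.k + 1), (∏ i ∈ Finset.Ico l j, F.t i y) • F.c j y

theorem A_succ {l : ℕ} (hl : l ≤ F.k) (y : Config n d) :
    F.A l y = F.c l y + F.t l y • F.A (l + 1) y := by
  rw [A, Finset.sum_eq_sum_Ico_succ_bot (by omega), Finset.Ico_self, Finset.prod_empty, one_smul,
    A, Finset.smul_sum]
  congr 1
  refine Finset.sum_congr rfl fun j hj => ?_
  rw [Finset.prod_eq_prod_Ico_succ_bot (by have := Finset.mem_Ico.mp hj; omega), smul_smul]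

theorem projE_c (hm : ∀ i, 0 < m i) {j : ℕ} (hj : j ≤ F.k) (y : Config n d) :
    projE m (F.D j) (F.c j y) = F.c j y := by
  rcases j with _ | j
  · exact projE_projE_of_le hm le_rfl y
  · simp only [c, projE_add, projE_sub, projE_smul, F.projE_succ_v j (by omega),
      projE_projE_of_le hm le_rfl, projE_projE_of_le hm (F.antitone (Nat.le_succ j))]

theorem projE_c_succ (hm : ∀ i, 0 < m i) {j : ℕ} (hj : j < F.k) (y : Config n d) :
    projE m (F.D j) (F.c (j + 1) y) = 0 := by
  simp only [c, projE_add, projE_sub, projE_smul, F.projE_v j hj,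
    projE_projE_of_le hm le_rfl, projE_projE_of_ge hm (F.antitone (Nat.le_succ j))]
  simp

/-- Each remaining shape c (j + 1) with j ≥ l is centred on the clusters of D j, hence on the
coarser clusters of D l. -/
theorem projE_A_succ (hm : ∀ i, 0 < m i) (l : ℕ) (y : Config n d) :
    projE m (F.D l) (F.A (l + 1) y) = 0 := by
  rw [A, projE_sum]
  refine Finset.sum_eq_zero fun j hj => ?_
  rw [Finset.mem_Ico] at hj
  obtain ⟨j, rfl⟩ : ∃ i, j = i + 1 := ⟨j - 1, by omega⟩
  rw [projE_smul, projE_eq_zero_of_le hm (F.antitone (show l ≤ j by omega))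
    (F.projE_c_succ hm (by omega) y), smul_zero]

theorem projE_A (hm : ∀ i, 0 < m i) {l : ℕ} (hl : l ≤ F.k) (y : Config n d) :
    projE m (F.D l) (F.A l y) = F.c l y := by
  rw [F.A_succ hl, projE_add, projE_smul, F.projE_A_succ hm, smul_zero, add_zero, F.projE_c hm hl]

/-- The component of y along v l serves as the scale t l and is replaced by 1 in the shape c (l +
1). This normalization makes A (l + 1) recoverable from its direction alone. -/
theorem massInner_A_succ (hm : ∀ i, 0 < m i) {l : ℕ} (hl : l < F.k) (y : Config n d) :
    massInner m (F.A (l + 1) y) (F.v l) = 1 := by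
  rw [← F.massInner_projE_succ_v hm hl, F.projE_A hm hl]
  simp only [c, massInner_sub_left, massInner_add_left, massInner_smul_left, F.massInner_v l hl,
    F.massInner_projE_succ_v hm hl, F.massInner_projE_v hm hl, t]
  ring

theorem massInner_A (hm : ∀ i, 0 < m i) {l : ℕ} (hl : l < F.k) (y : Config n d) :
    massInner m (F.A l y) (F.v l) = F.t l y := by
  rw [F.A_succ hl.le, massInner_add_left, massInner_smul_left, F.massInner_A_succ hm hl,
    F.massInner_v_of_projE hm hl (F.projE_c hm hl.le y)]
  ring

/-- The total scale of level `l`. -/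
noncomputable def scale (l : ℕ) (y : Config n d) : ℝ := ∏ i ∈ Finset.range l, F.t i y

/-- The shapes c j with j < l are constant on the clusters of D j ≥ C, so `projI` at C kills them
and only the factors t j remain. -/
theorem projI_A_zero (hm : ∀ i, 0 < m i) {C : Clusters n} {l : ℕ} (hl : l ≤ F.k)
    (h : ∀ j < l, C ≤ F.D j) (y : Config n d) :
    projI m C (F.A 0 y) = F.scale l y • projI m C (F.A l y) := by
  induction l with
  | zero => simp [scale]
  | succ l ih =>
    rw [ih (by omega) fun j hj => h j (by omega), F.A_succ (by omega), projI_add, projI_smul,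
      projI_eq_zero_iff.mpr (projE_eq_of_le hm (h l (by omega)) (F.projE_c hm (by omega) y)),
      zero_add, smul_smul, scale, scale, Finset.prod_range_succ]

theorem A_zero_mem (hm : ∀ i, 0 < m i) {y : Config n d} (hy : y ∈ comSpace d m) :
    F.A 0 y ∈ comSpace d m := by
  rw [F.A_succ (Nat.zero_le _)]
  exact (comSubmodule d m).add_mem (projE_mem m hm (F.D 0) y hy).1
    ((comSubmodule d m).smul_mem _ (mem_comSpace_of_projE_eq_zero hm (F.projE_A_succ hm 0 y)))

theorem t_base (hm : ∀ i, 0 < m i) {l : ℕ} (hl : l < F.k) : F.t l F.base = 0 :=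
  F.massInner_v_of_projE hm hl (projE_eq_of_le hm (F.antitone (Nat.zero_le l)) F.projE_base)

theorem A_zero_base (hm : ∀ i, 0 < m i) : F.A 0 F.base = F.base := by
  rw [F.A_succ (Nat.zero_le _)]
  rcases Nat.eq_zero_or_pos F.k with h | h
  · simp [A, h, c, F.projE_base]
  · simp [F.t_base hm h, c, F.projE_base]

/-- At the base point all scales vanish, so A (l + 1) reduces to c (l + 1), in which the projections
of the base cancel. -/
theorem A_succ_base (hm : ∀ i, 0 < m i) {l : ℕ} (hl : l < F.k) :
    F.A (l + 1) F.base = F.v l := by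
  have hc : F.c (l + 1) F.base = F.v l := by
    simp only [c, F.t_base hm hl,
      projE_eq_of_le hm (F.antitone (Nat.zero_le _)) F.projE_base]
    simp
  rw [F.A_succ hl, hc]
  rcases Nat.lt_or_ge (l + 1) F.k with h | h
  · simp [F.t_base hm h]
  · simp [A, show F.k = l + 1 by omega]

/-- The first level at which the chain does not lie above `C`. -/
noncomputable def lev (C : Clusters n) : ℕ := sInf {l | ¬ C ≤ F.D l}

theorem lev_le {C : Clusters n} (hC : C ≠ ⊥) : F.lev C ≤ F.k :=
  Nat.sInf_le (by simpa [F.D_k] using hC)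

theorem not_le_D_lev {C : Clusters n} (hC : C ≠ ⊥) : ¬ C ≤ F.D (F.lev C) :=
  Nat.sInf_mem (s := {l | ¬ C ≤ F.D l}) ⟨F.k, by simpa [F.D_k] using hC⟩

theorem le_D_of_lt_lev {C : Clusters n} {j : ℕ} (hj : j < F.lev C) : C ≤ F.D j := by
  by_contra h
  exact Nat.notMem_of_lt_sInf hj h

/-- The step from D l to D (l + 1) is strict: v l is nonzero, centred on the clusters of D l and
constant on those of D (l + 1). -/
theorem lev_D (hm : ∀ i, 0 < m i) {l : ℕ} (hl : l < F.k) : F.lev (F.D l) = l + 1 := by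
  apply le_antisymm
  · refine Nat.sInf_le fun h => ?_
    have h1 := projE_eq_of_le hm h (F.projE_succ_v l hl)
    rw [F.projE_v l hl] at h1
    have h2 := F.massInner_v l hl
    rw [← h1, massInner_zero_left] at h2
    exact zero_ne_one h2
  · by_contra h
    exact F.not_le_D_lev (F.D_ne_bot hm hl) (F.antitone (by omega))

/-- The part of the configuration internal to the clusters of `C`, in the scale at which it is
seen. -/
noncomputable def B (C : Clusters n) (y : Config n d) : Config n d := projI m C (F.A (F.lev C) y)

theorem projI_A_zero_eq (hm : ∀ i, 0 < m i) {C : Clusters n} (hC : C ≠ ⊥) (y : Config n d) :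
    projI m C (F.A 0 y) = F.scale (F.lev C) y • F.B C y :=
  F.projI_A_zero hm (F.lev_le hC) (fun _ hj => F.le_D_of_lt_lev hj) y

theorem B_base_ne (hm : ∀ i, 0 < m i) {C : Clusters n} (hC : C ≠ ⊥) : F.B C F.base ≠ 0 := by
  have h1 := F.not_le_D_lev hC
  have h2 := F.lev_le hC
  have h3 : ∀ j, j < F.lev C → C ≤ F.D j := fun j => F.le_D_of_lt_lev
  unfold B
  rcases h : F.lev C with _ | l
  · rw [F.A_zero_base hm]
    exact F.projI_base_ne C (by rwa [h] at h1)
  · rw [F.A_succ_base hm (by omega)]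
    exact F.projI_v_ne l (by omega) C (h3 l (by omega)) (by rwa [h] at h1)

theorem B_D (hm : ∀ i, 0 < m i) {l : ℕ} (hl : l < F.k) (y : Config n d) :
    F.B (F.D l) y = F.A (l + 1) y := by
  rw [B, F.lev_D hm hl, projI, F.projE_A_succ hm, sub_zero]

/-- The local parametrization of the blow-up. -/
noncomputable def param (y : Config n d) : CollisionClusters n → BlowUpAmbient n d := fun C =>
  (projE m C.1 (F.A 0 y), F.scale (F.lev C.1) y * √(massInner m (F.B C.1 y) (F.B C.1 y)),
    (√(massInner m (F.B C.1 y) (F.B C.1 y)))⁻¹ • F.B C.1 y)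

theorem sqrt_massInner_pos (hm : ∀ i, 0 < m i) {q : Config n d} (hq : q ≠ 0) :
    0 < √(massInner m q q) := Real.sqrt_pos.mpr (massInner_self_pos m hm q hq)

theorem scale_pos {l : ℕ} {y : Config n d} (h : ∀ i < l, 0 < F.t i y) : 0 < F.scale l y :=
  Finset.prod_pos fun i hi => h i (Finset.mem_range.mp hi)

theorem param_eq_diagonalMap (hm : ∀ i, 0 < m i) {y : Config n d}
    (ht : ∀ l < F.k, 0 < F.t l y) : F.param y = diagonalMap m (F.A 0 y) := by
  funext C
  have hs : 0 < F.scale (F.lev C.1) y :=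
    F.scale_pos fun i hi => ht i (hi.trans_le (F.lev_le C.2))
  simp only [param, diagonalMap, F.projI_A_zero_eq hm C.2, massInner_smul_smul,
    Real.sqrt_mul (sq_nonneg _), Real.sqrt_sq hs.le, smul_smul]
  congr 3
  rw [mul_inv_rev, mul_assoc, inv_mul_cancel₀ hs.ne', mul_one]

theorem param_mem_blowUp (hm : ∀ i, 0 < m i) {y : Config n d} (hy : y ∈ comSpace d m)
    (ht : ∀ l < F.k, 0 ≤ F.t l y) (C : CollisionClusters n) (hB : F.B C.1 y ≠ 0) :
    F.param y C ∈ blowUp d m C.1 := by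
  have hpos := massInner_self_pos m hm _ hB
  refine ⟨projE_mem m hm C.1 _ (F.A_zero_mem hm hy), ?_, ?_, ?_⟩
  · exact mul_nonneg (Finset.prod_nonneg fun i hi =>
      ht i ((Finset.mem_range.mp hi).trans_le (F.lev_le C.2))) (Real.sqrt_nonneg _)
  · simp only [param, B, ← projI_smul]
    exact projI_mem m hm C.1 _
  · simp only [param, massInner_smul_smul, inv_pow, Real.sq_sqrt hpos.le]
    exact inv_mul_cancel₀ hpos.ne'

/-- The reconstruction of the parameters from the configurations seen at the various scales. -/
noncomputable def recon (a : ℕ → Config n d) : Config n d :=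
  projE m (F.D 0) (a 0) + ∑ l ∈ Finset.range F.k,
    (projE m (F.D (l + 1)) (a (l + 1)) - F.v l + massInner m (a l) (F.v l) • F.v l)

/-- The l-th summand of `recon` is the difference of the projections of y to the levels l + 1 and l;
the sum telescopes up to D k = ⊥, whose projection is the identity. -/
theorem recon_A (hm : ∀ i, 0 < m i) {y : Config n d} {a : ℕ → Config n d}
    (ha : ∀ l ≤ F.k, a l = F.A l y) : F.recon a = y := by
  have h : ∀ l ∈ Finset.range F.k,
      projE m (F.D (l + 1)) (a (l + 1)) - F.v l + massInner m (a l) (F.v l) • F.v l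
        = projE m (F.D (l + 1)) y - projE m (F.D l) y := fun l hl => by
    have hl := Finset.mem_range.mp hl
    rw [ha l hl.le, ha (l + 1) hl, F.massInner_A hm hl, F.projE_A hm hl, c]
    abel
  rw [recon, Finset.sum_congr rfl h, Finset.sum_range_sub (fun l => projE m (F.D l) y),
    ha 0 (Nat.zero_le _), F.projE_A hm (Nat.zero_le _), c, F.D_k, projE_bot hm]
  abel

/-- The j-th summand is constant on the clusters of D (j + 1) and centred on those of D j, so the
projection at D l keeps it for j < l and kills it for j ≥ l. -/
theorem projE_recon (hm : ∀ i, 0 < m i) {a : ℕ → Config n d}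
    (ha : ∀ l < F.k, projE m (F.D l) (a (l + 1)) = 0) {l : ℕ} (hl : l ≤ F.k) :
    projE m (F.D l) (F.recon a) = projE m (F.D 0) (a 0) + ∑ j ∈ Finset.range l,
      (projE m (F.D (j + 1)) (a (j + 1)) - F.v j + massInner m (a j) (F.v j) • F.v j) := by
  rw [recon, projE_add, projE_projE_of_le hm (F.antitone (Nat.zero_le l)), projE_sum,
    ← Finset.sum_range_add_sum_Ico _ hl, Finset.sum_eq_zero (s := Finset.Ico l F.k), add_zero]
  · congr 1
    refine Finset.sum_congr rfl fun j hj => ?_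
    have hj := Finset.mem_range.mp hj
    refine projE_eq_of_le hm (F.antitone (Nat.succ_le_of_lt hj)) ?_
    rw [projE_add, projE_sub, projE_smul, F.projE_succ_v j (by omega),
      projE_projE_of_le hm le_rfl]
  · intro j hj
    have hj := Finset.mem_Ico.mp hj
    refine projE_eq_zero_of_le hm (F.antitone hj.1) ?_
    rw [projE_add, projE_sub, projE_smul, F.projE_v j hj.2,
      projE_projE_of_ge hm (F.antitone (Nat.le_succ j)), ha j hj.2]
    simp

theorem t_recon (hm : ∀ i, 0 < m i) {a : ℕ → Config n d}
    (ha : ∀ l < F.k, projE m (F.D l) (a (l + 1)) = 0)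
    (ha' : ∀ l < F.k, massInner m (a (l + 1)) (F.v l) = 1) {l : ℕ} (hl : l < F.k) :
    F.t l (F.recon a) = massInner m (a l) (F.v l) := by
  have h1 := F.massInner_projE_succ_v hm hl (F.recon a)
  have h2 := F.massInner_projE_v hm hl (F.recon a)
  rw [F.projE_recon hm ha hl, Finset.sum_range_succ, ← add_assoc,
    ← F.projE_recon hm ha hl.le, massInner_add_left, h2, massInner_add_left,
    massInner_sub_left, massInner_smul_left, F.massInner_v l hl, F.massInner_projE_succ_v hm hl,
    ha' l hl] at h1
  rw [t, ← h1]
  ring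

theorem c_recon (hm : ∀ i, 0 < m i) {a : ℕ → Config n d}
    (ha : ∀ l < F.k, projE m (F.D l) (a (l + 1)) = 0)
    (ha' : ∀ l < F.k, massInner m (a (l + 1)) (F.v l) = 1) {l : ℕ} (hl : l ≤ F.k) :
    F.c l (F.recon a) = projE m (F.D l) (a l) := by
  rcases l with _ | l
  · rw [c, F.projE_recon hm ha hl]
    simp
  · rw [c, F.t_recon hm ha ha' hl, F.projE_recon hm ha hl,
      F.projE_recon hm ha (Nat.le_of_succ_le hl), Finset.sum_range_succ]
    abel

/-- The reconstructed scales are t 0 = ⟨q, v 0⟩ and t (l + 1) = ⟨q, v (l + 1)⟩ / ⟨q, v l⟩. Their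
products telescope to ⟨q, v l⟩, which cancels the normalization of a (l + 1), and the sum defining A
0 telescopes to q. -/
theorem A_zero_recon (hm : ∀ i, 0 < m i) {q : Config n d} (hq : ∀ l < F.k, 0 < massInner m q (F.v l))
    {a : ℕ → Config n d} (ha0 : a 0 = q)
    (ha : ∀ l < F.k, a (l + 1) = (massInner m q (F.v l))⁻¹ • projI m (F.D l) q) :
    (∀ l < F.k, 0 < F.t l (F.recon a)) ∧ F.A 0 (F.recon a) = q := by
  have h1 : ∀ l < F.k, projE m (F.D l) (a (l + 1)) = 0 := fun l hl => by
    rw [ha l hl, projE_smul, projI, projE_sub, projE_projE_of_le hm le_rfl, sub_self, smul_zero]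
  have h2 : ∀ l < F.k, massInner m (a (l + 1)) (F.v l) = 1 := fun l hl => by
    rw [ha l hl, massInner_smul_left, projI, massInner_sub_left, F.massInner_projE_v hm hl,
      sub_zero, inv_mul_cancel₀ (hq l hl).ne']
  have ht0 : 0 < F.k → F.t 0 (F.recon a) = massInner m q (F.v 0) := fun h => by
    rw [F.t_recon hm h1 h2 h, ha0]
  have ht : ∀ l, l + 1 < F.k → F.t (l + 1) (F.recon a)
      = (massInner m q (F.v l))⁻¹ * massInner m q (F.v (l + 1)) := fun l hl => by
    rw [F.t_recon hm h1 h2 hl, ha l (by omega), massInner_smul_left, projI, massInner_sub_left,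
      F.massInner_v_of_projE hm hl (q := projE m (F.D l) q), sub_zero]
    exact projE_projE_of_le hm (F.antitone (Nat.le_succ l)) q
  refine ⟨fun l hl => ?_, ?_⟩
  · rcases l with _ | l
    · rw [ht0 hl]; exact hq 0 hl
    · rw [ht l hl]; exact mul_pos (inv_pos.mpr (hq l (by omega))) (hq _ hl)
  · have hscale : ∀ l < F.k, F.scale (l + 1) (F.recon a) = massInner m q (F.v l) := by
      intro l hl
      induction l with
      | zero => simp [scale, ht0 hl]
      | succ l ih =>
        rw [scale, Finset.prod_range_succ, ← scale, ih (by omega), ht l hl,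
          mul_inv_cancel_left₀ (hq l (by omega)).ne']
    have hterm : ∀ l ∈ Finset.range F.k,
        (∏ i ∈ Finset.Ico 0 (l + 1), F.t i (F.recon a)) • F.c (l + 1) (F.recon a)
          = projE m (F.D (l + 1)) q - projE m (F.D l) q := fun l hl => by
      have hl := Finset.mem_range.mp hl
      rw [← Finset.range_eq_Ico, ← scale, hscale l hl, F.c_recon hm h1 h2 hl, ha l hl, projE_smul,
        smul_smul, mul_inv_cancel₀ (hq l hl).ne', one_smul, projI, projE_sub,
        projE_projE_of_le hm (F.antitone (Nat.le_succ l))]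
    rw [A, ← Finset.range_eq_Ico, Finset.sum_range_succ', Finset.sum_congr rfl hterm,
      Finset.sum_range_sub (fun l => projE m (F.D l) q), F.c_recon hm h1 h2 (Nat.zero_le _), ha0,
      F.D_k, projE_bot hm]
    simp

end Flag

end Flags

/-! ### Collisions, blow-down, and the flag of a point of the blow-up. -/

section BlowUpPoints

variable {n d : ℕ} {m : Fin n → ℝ}

theorem projE_eq_zero_of_mem_internalSpace (hm : ∀ i, 0 < m i) {C : Clusters n} {q : Config n d}
    (hq : q ∈ internalSpace d m C) : projE m C q = 0 := by
  by_contra hne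
  have h1 := massInner_self_pos m hm _ hne
  rw [massInner_projE_left hm, projE_projE_of_le hm le_rfl, hq.2 _ (projE_mem m hm C q hq.1)] at h1
  exact lt_irrefl _ h1

theorem exists_part_eq_of_ne_bot {C : Clusters n} (hC : C ≠ ⊥) :
    ∃ i j, i < j ∧ C.part i = C.part j := by
  by_contra h
  push Not at h
  refine hC (le_bot_iff.mp (le_of_part_eq fun i j hij => ?_))
  rcases lt_trichotomy i j with hlt | rfl | hlt
  · exact absurd hij (h i j hlt)
  · rfl
  · exact absurd hij.symm (h j i hlt)

/-- The partition whose only block that is not a singleton is `{i, j}`. -/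
noncomputable def pairPart (i j : Fin n) : Clusters n :=
  kerPart (Function.update id i j)

theorem pairPart_part_eq (i j : Fin n) : (pairPart i j).part i = (pairPart i j).part j := by
  rw [pairPart, kerPart_part_eq_iff, Function.update_self, Function.update_apply]
  split_ifs <;> rfl

theorem pairPart_le_iff {i j : Fin n} {C : Clusters n} :
    pairPart i j ≤ C ↔ C.part i = C.part j := by
  refine ⟨fun h => part_eq_of_le h (pairPart_part_eq i j), fun h => le_of_part_eq fun a b hab => ?_⟩
  rw [pairPart, kerPart_part_eq_iff, Function.update_apply, Function.update_apply] at hab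
  split_ifs at hab with ha hb hb
  · rw [ha, hb]
  · rw [ha, h, hab, id]
  · rw [hb, h, ← hab, id]
  · exact congrArg _ hab

theorem pairPart_ne_bot {i j : Fin n} (h : i ≠ j) : pairPart i j ≠ ⊥ := fun hb =>
  h (part_bot_injective (by rw [← hb]; exact pairPart_part_eq i j))

theorem projI_pairPart_eq_zero_iff (hm : ∀ i, 0 < m i) {i j : Fin n} {q : Config n d} :
    projI m (pairPart i j) q = 0 ↔ q i = q j := by
  have : pairPart i j ≤ kerPart q ↔ projE m (pairPart i j) q = q := by
    rw [projE_eq_self_iff hm]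
    exact ⟨fun h a b hab => (kerPart_part_eq_iff q).mp (part_eq_of_le h hab),
      fun h => le_of_part_eq fun a b hab => (kerPart_part_eq_iff q).mpr (h a b hab)⟩
  rw [projI_eq_zero_iff, ← this, pairPart_le_iff, kerPart_part_eq_iff]

theorem mem_noncollision_iff (hm : ∀ i, 0 < m i) {q : Config n d} :
    q ∈ noncollision d m ↔ q ∈ comSpace d m ∧ ∀ C : CollisionClusters n, projI m C.1 q ≠ 0 := by
  constructor
  · rintro ⟨hq, h⟩
    refine ⟨hq, fun C hC => ?_⟩
    obtain ⟨i, j, hij, hp⟩ := exists_part_eq_of_ne_bot C.2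
    exact h i j hij.ne ((projE_eq_self_iff hm).mp (projI_eq_zero_iff.mp hC) i j hp)
  · rintro ⟨hq, h⟩
    exact ⟨hq, fun i j hij hqij => h ⟨pairPart i j, pairPart_ne_bot hij⟩
      ((projI_pairPart_eq_zero_iff hm).mpr hqij)⟩

/-- The blow-down map, read off from the component `C`. -/
noncomputable def blowDown (C : CollisionClusters n) (x : CollisionClusters n → BlowUpAmbient n d) :
    Config n d :=
  (x C).1 + (x C).2.1 • (x C).2.2

theorem blowDown_diagonalMap (hm : ∀ i, 0 < m i) (C : CollisionClusters n) (q : Config n d) :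
    blowDown C (diagonalMap m q) = q := by
  simp only [blowDown, diagonalMap]
  by_cases h : projI m C.1 q = 0
  · rw [h, smul_zero, smul_zero, add_zero]
    exact projI_eq_zero_iff.mp h
  · rw [smul_smul, mul_inv_cancel₀ (Flag.sqrt_massInner_pos hm h).ne', one_smul, projE_add_projI]

theorem blowDown_mem (C : CollisionClusters n)
    {x : CollisionClusters n → BlowUpAmbient n d} (hx : x ∈ totalBlowUp d m) :
    blowDown C x ∈ comSpace d m :=
  (comSubmodule d m).add_mem (hx.1 C).1.1 ((comSubmodule d m).smul_mem _ (hx.1 C).2.2.1.1)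

/-- D 0 records the coincidences of the blow-down, and D (l + 1) splits the clusters of D l by the
values of the spherical component at D l. That component is a unit vector centred on D l, so the
splitting is strict and reaches ⊥, there being finitely many partitions. -/
theorem exists_flag (hm : ∀ i, 0 < m i) (C₀ : CollisionClusters n)
    {x : CollisionClusters n → BlowUpAmbient n d} (hx : x ∈ totalBlowUp d m) :
    ∃ F : Flag d m, F.base = blowDown C₀ x ∧
      ∀ l < F.k, ∀ h : F.D l ≠ ⊥, F.v l = (x ⟨F.D l, h⟩).2.2 := by
  classical
  let q₀ := blowDown C₀ x
  -- The value 0 at ⊥ only serves to make the recursion below total.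
  let Q : Clusters n → Config n d := fun C => if h : C ≠ ⊥ then (x ⟨C, h⟩).2.2 else 0
  have hQ : ∀ C (h : C ≠ ⊥), Q C = (x ⟨C, h⟩).2.2 := fun C h => dif_pos h
  let D : ℕ → Clusters n := fun l => Nat.rec (kerPart q₀)
    (fun _ C => kerPart fun i => (C.part i, Q C i)) l
  have hD : ∀ l i j, (D (l + 1)).part i = (D (l + 1)).part j ↔
      (D l).part i = (D l).part j ∧ Q (D l) i = Q (D l) j := fun l i j => by
    change (kerPart fun i => ((D l).part i, Q (D l) i)).part i =
      (kerPart fun i => ((D l).part i, Q (D l) i)).part j ↔ _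
    rw [kerPart_part_eq_iff, Prod.mk.injEq]
  have hanti : Antitone D := antitone_nat_of_succ_le fun l =>
    le_of_part_eq fun i j hij => ((hD l i j).mp hij).1
  have hQ0 : ∀ l, D l ≠ ⊥ → projE m (D l) (Q (D l)) = 0 := fun l h => by
    rw [hQ _ h]; exact projE_eq_zero_of_mem_internalSpace hm (hx.1 ⟨D l, h⟩).2.2.1
  have hQ1 : ∀ l, projE m (D (l + 1)) (Q (D l)) = Q (D l) := fun l =>
    (projE_eq_self_iff hm).mpr fun i j hij => ((hD l i j).mp hij).2
  have hQn : ∀ l, D l ≠ ⊥ → massInner m (Q (D l)) (Q (D l)) = 1 := fun l h => by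
    rw [hQ _ h]; exact (hx.1 ⟨D l, h⟩).2.2.2
  have hex : ∃ l, D l = ⊥ := by
    by_contra! h
    have hstrict : StrictAnti D := strictAnti_nat_of_succ_lt fun l => by
      refine lt_of_le_of_ne (hanti (Nat.le_succ l)) fun he => ?_
      have h1 := hQ1 l
      rw [he, hQ0 l (h l)] at h1
      have h2 := hQn l (h l)
      rw [← h1, massInner_zero_left] at h2
      exact zero_ne_one h2
    exact not_injective_infinite_finite D hstrict.injective
  obtain ⟨k, hk, hlt⟩ : ∃ k, D k = ⊥ ∧ ∀ l < k, D l ≠ ⊥ :=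
    ⟨sInf {l | D l = ⊥}, Nat.sInf_mem hex, fun l hl h => Nat.notMem_of_lt_sInf hl h⟩
  let F : Flag d m :=
    { k := k
      D := D
      v := fun l => Q (D l)
      base := q₀
      base_mem := blowDown_mem C₀ hx
      antitone := hanti
      D_k := hk
      projE_base :=
        (projE_eq_self_iff hm).mpr fun i j hij => (kerPart_part_eq_iff q₀).mp hij
      projE_v := fun l hl => hQ0 l (hlt l hl)
      projE_succ_v := fun l _ => hQ1 l
      massInner_v := fun l hl => hQn l (hlt l hl)
      projI_base_ne := fun C hC h0 => by
        rw [projI_eq_zero_iff, projE_eq_self_iff hm] at h0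
        exact hC (le_of_part_eq fun i j hij => (kerPart_part_eq_iff q₀).mpr (h0 i j hij))
      projI_v_ne := fun l hl C hC hC' h0 => by
        rw [projI_eq_zero_iff, projE_eq_self_iff hm] at h0
        exact hC' (le_of_part_eq fun i j hij =>
          (hD l i j).mpr ⟨part_eq_of_le hC hij, h0 i j hij⟩) }
  exact ⟨F, rfl, fun l _ h => hQ _ h⟩

end BlowUpPoints

/-! ### Smoothness of the parametrization and of its inverse. -/

section LocalCharts

variable {n d : ℕ} {m : Fin n → ℝ}

theorem contDiff_massInner {E : Type*} [NormedAddCommGroup E] [NormedSpace ℝ E]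
    {f g : E → Config n d} (hf : ContDiff ℝ ∞ f) (hg : ContDiff ℝ ∞ g) :
    ContDiff ℝ ∞ fun x => massInner m (f x) (g x) := by
  unfold massInner
  exact ContDiff.sum fun i _ => contDiff_const.mul
    (ContDiff.inner ℝ (contDiff_pi.mp hf i) (contDiff_pi.mp hg i))

theorem contDiff_projE (C : Clusters n) :
    ContDiff ℝ ∞ (projE m C : Config n d → Config n d) :=
  (projEL m C).toContinuousLinearMap.contDiff

theorem contDiff_projI (C : Clusters n) :
    ContDiff ℝ ∞ (projI m C : Config n d → Config n d) :=
  contDiff_id.sub (contDiff_projE C)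

namespace Flag

variable (F : Flag d m)

theorem contDiff_t (l : ℕ) : ContDiff ℝ ∞ (F.t l) := contDiff_massInner contDiff_id contDiff_const

theorem contDiff_c (l : ℕ) : ContDiff ℝ ∞ (F.c l) := by
  rcases l with _ | l
  · exact contDiff_projE _
  · exact (contDiff_const.add ((contDiff_projE _).sub (contDiff_projE _))).sub
      ((F.contDiff_t l).smul contDiff_const)

theorem contDiff_A (l : ℕ) : ContDiff ℝ ∞ (F.A l) := by
  unfold A
  exact ContDiff.sum fun j _ => (contDiff_prod fun i _ => F.contDiff_t i).smul (F.contDiff_c j)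

theorem contDiff_scale (l : ℕ) : ContDiff ℝ ∞ (F.scale l) := by
  unfold scale
  exact contDiff_prod fun i _ => F.contDiff_t i

theorem contDiff_B (C : Clusters n) : ContDiff ℝ ∞ (F.B C) :=
  (contDiff_projI C).comp (F.contDiff_A _)

theorem contDiffAt_param (hm : ∀ i, 0 < m i) {y : Config n d}
    (hy : ∀ C : CollisionClusters n, F.B C.1 y ≠ 0) : ContDiffAt ℝ ∞ F.param y := by
  refine contDiffAt_pi.mpr fun C => ?_
  have hpos := massInner_self_pos m hm _ (hy C)
  have hB := (F.contDiff_B C.1).contDiffAt (x := y)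
  have hn : ContDiffAt ℝ ∞ (fun y => √(massInner m (F.B C.1 y) (F.B C.1 y))) y :=
    ContDiffAt.sqrt (contDiff_massInner (F.contDiff_B C.1) (F.contDiff_B C.1)).contDiffAt hpos.ne'
  exact (((contDiff_projE C.1).comp (F.contDiff_A 0)).contDiffAt).prodMk
    (((F.contDiff_scale _).contDiffAt.mul hn).prodMk
      ((hn.inv (Real.sqrt_pos.mpr hpos).ne').smul hB))

open Classical in
/-- `D l` as an index of the blow-up. -/
noncomputable def idx (C₀ : CollisionClusters n) (l : ℕ) : CollisionClusters n :=
  if h : F.D l ≠ ⊥ then ⟨F.D l, h⟩ else C₀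

theorem idx_eq (hm : ∀ i, 0 < m i) (C₀ : CollisionClusters n) {l : ℕ} (hl : l < F.k) :
    F.idx C₀ l = ⟨F.D l, F.D_ne_bot hm hl⟩ := dif_pos (F.D_ne_bot hm hl)

/-- The configurations seen at the various scales, as functions on the blow-up. -/
noncomputable def seen (C₀ : CollisionClusters n) (x : CollisionClusters n → BlowUpAmbient n d) :
    ℕ → Config n d
  | 0 => blowDown C₀ x
  | l + 1 => (massInner m (x (F.idx C₀ l)).2.2 (F.v l))⁻¹ • (x (F.idx C₀ l)).2.2

/-- The domain of the coordinates. -/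
def chartDomain (C₀ : CollisionClusters n) : Set (CollisionClusters n → BlowUpAmbient n d) :=
  {x | ∀ l < F.k, 0 < massInner m (x (F.idx C₀ l)).2.2 (F.v l)}

theorem contDiff_massInner_idx (C₀ : CollisionClusters n) (l : ℕ) :
    ContDiff ℝ ∞ fun x : CollisionClusters n → BlowUpAmbient n d =>
      massInner m (x (F.idx C₀ l)).2.2 (F.v l) :=
  contDiff_massInner (contDiff_snd.snd.comp (contDiff_apply ℝ (BlowUpAmbient n d) (F.idx C₀ l)))
    contDiff_const

theorem isOpen_chartDomain (C₀ : CollisionClusters n) : IsOpen (F.chartDomain C₀) := by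
  have : F.chartDomain C₀ = ⋂ l ∈ Finset.range F.k,
      {x | 0 < massInner m (x (F.idx C₀ l)).2.2 (F.v l)} := by
    ext x
    simp [chartDomain]
  rw [this]
  exact isOpen_biInter_finset fun l _ =>
    isOpen_lt continuous_const (F.contDiff_massInner_idx C₀ l).continuous

theorem contDiffOn_recon_seen (C₀ : CollisionClusters n) :
    ContDiffOn ℝ ∞ (fun x => F.recon (F.seen C₀ x)) (F.chartDomain C₀) := by
  have hseen : ∀ l ≤ F.k, ContDiffOn ℝ ∞ (fun x => F.seen C₀ x l) (F.chartDomain C₀) := by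
    rintro (_ | l) hl
    · have : ContDiff ℝ ∞ fun x : CollisionClusters n → BlowUpAmbient n d => blowDown C₀ x := by
        unfold blowDown
        fun_prop
      exact this.contDiffOn
    · exact ((F.contDiff_massInner_idx C₀ l).contDiffOn.inv fun x hx => (hx l hl).ne').smul
        (contDiff_snd.snd.comp (contDiff_apply ℝ (BlowUpAmbient n d) (F.idx C₀ l))).contDiffOn
  have hP : ∀ C : Clusters n, ∀ l ≤ F.k,
      ContDiffOn ℝ ∞ (fun x => projE m C (F.seen C₀ x l)) (F.chartDomain C₀) := fun C l hl =>
    (contDiff_projE C).comp_contDiffOn (hseen l hl)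
  have hI : ∀ l ≤ F.k, ContDiffOn ℝ ∞ (fun x => massInner m (F.seen C₀ x l) (F.v l))
      (F.chartDomain C₀) := fun l hl =>
    (contDiff_massInner contDiff_id contDiff_const).comp_contDiffOn (hseen l hl)
  refine (hP _ 0 (Nat.zero_le _)).add (ContDiffOn.sum fun l hl => ?_)
  have hl := Finset.mem_range.mp hl
  exact ((hP _ (l + 1) hl).sub contDiffOn_const).add ((hI l hl.le).smul contDiffOn_const)

/-- The spherical component at D l is A (l + 1) divided by its norm. As ⟨A (l + 1), v l⟩ = 1, its
product with v l is the inverse norm, and dividing by it restores A (l + 1). -/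
theorem seen_param (hm : ∀ i, 0 < m i) (C₀ : CollisionClusters n) {y : Config n d}
    (hy : ∀ C : CollisionClusters n, F.B C.1 y ≠ 0) :
    F.param y ∈ F.chartDomain C₀ ∧ ∀ l ≤ F.k, F.seen C₀ (F.param y) l = F.A l y := by
  have hpos : ∀ C : CollisionClusters n, 0 < √(massInner m (F.B C.1 y) (F.B C.1 y)) := fun C =>
    sqrt_massInner_pos hm (hy C)
  have h : ∀ l < F.k, (F.param y (F.idx C₀ l)).2.2
      = (√(massInner m (F.A (l + 1) y) (F.A (l + 1) y)))⁻¹ • F.A (l + 1) y := fun l hl => by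
    simp only [param, F.idx_eq hm C₀ hl, F.B_D hm hl]
  have hpos' : ∀ l < F.k, 0 < √(massInner m (F.A (l + 1) y) (F.A (l + 1) y)) := fun l hl => by
    have := hpos ⟨F.D l, F.D_ne_bot hm hl⟩
    rwa [F.B_D hm hl] at this
  refine ⟨fun l hl => ?_, ?_⟩
  · rw [h l hl, massInner_smul_left, F.massInner_A_succ hm hl, mul_one]
    exact inv_pos.mpr (hpos' l hl)
  · rintro (_ | l) hl
    · simp only [seen, blowDown, param]
      rw [smul_smul, mul_assoc, mul_inv_cancel₀ (hpos C₀).ne', mul_one,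
        ← F.projI_A_zero_eq hm C₀.2, projE_add_projI]
    · rw [seen, h l hl, massInner_smul_left, F.massInner_A_succ hm hl, mul_one, inv_inv, smul_smul,
        mul_inv_cancel₀ (hpos' l hl).ne', one_smul]

/-- The spherical component at D l is a positive multiple of `projI m (F.D l) q`. So the chart
domain condition says ⟨q, v l⟩ > 0, the norms cancel in `seen`, and `A_zero_recon` applies. -/
theorem recon_seen_diagonalMap (hm : ∀ i, 0 < m i) (C₀ : CollisionClusters n) {q : Config n d}
    (hq : q ∈ noncollision d m) (h : diagonalMap m q ∈ F.chartDomain C₀) :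
    F.recon (F.seen C₀ (diagonalMap m q)) ∈ comSpace d m ∧
      (∀ l < F.k, 0 < F.t l (F.recon (F.seen C₀ (diagonalMap m q)))) ∧
      F.param (F.recon (F.seen C₀ (diagonalMap m q))) = diagonalMap m q := by
  have hpos : ∀ C : CollisionClusters n, 0 < √(massInner m (projI m C.1 q) (projI m C.1 q)) :=
    fun C => sqrt_massInner_pos hm (((mem_noncollision_iff hm).mp hq).2 C)
  have hinner : ∀ l < F.k, massInner m (projI m (F.D l) q) (F.v l) = massInner m q (F.v l) :=
    fun l hl => by rw [projI, massInner_sub_left, F.massInner_projE_v hm hl, sub_zero]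
  have hd : ∀ l < F.k, (diagonalMap m q (F.idx C₀ l)).2.2
      = (√(massInner m (projI m (F.D l) q) (projI m (F.D l) q)))⁻¹ • projI m (F.D l) q :=
    fun l hl => by rw [F.idx_eq hm C₀ hl]; rfl
  have hv : ∀ l < F.k, 0 < massInner m q (F.v l) := fun l hl => by
    have h1 := h l hl
    rw [hd l hl, massInner_smul_left, hinner l hl] at h1
    exact (mul_pos_iff_of_pos_left (inv_pos.mpr (hpos ⟨F.D l, F.D_ne_bot hm hl⟩))).mp h1
  have h0 : F.seen C₀ (diagonalMap m q) 0 = q := blowDown_diagonalMap hm C₀ q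
  have h1 : ∀ l < F.k, F.seen C₀ (diagonalMap m q) (l + 1)
      = (massInner m q (F.v l))⁻¹ • projI m (F.D l) q := fun l hl => by
    have hne := (hpos ⟨F.D l, F.D_ne_bot hm hl⟩).ne'
    rw [seen, hd l hl, massInner_smul_left, hinner l hl, smul_smul, mul_inv_rev, inv_inv, mul_assoc,
      mul_inv_cancel₀ hne, mul_one]
  obtain ⟨ht, hA⟩ := F.A_zero_recon hm hv h0 h1
  refine ⟨?_, ht, by rw [F.param_eq_diagonalMap hm ht, hA]⟩
  refine (comSubmodule d m).add_mem ?_ ((comSubmodule d m).sum_mem fun l hl => ?_)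
  · rw [h0]
    exact (projE_mem m hm _ q hq.1).1
  · have hl := Finset.mem_range.mp hl
    refine (comSubmodule d m).add_mem ((comSubmodule d m).sub_mem ?_ (F.v_mem hm hl))
      ((comSubmodule d m).smul_mem _ (F.v_mem hm hl))
    refine (projE_mem m hm _ _ ?_).1
    rw [h1 l hl]
    exact (comSubmodule d m).smul_mem _ (projI_mem m hm _ q).1

theorem A_zero_mem_noncollision (hm : ∀ i, 0 < m i) {y : Config n d} (hy : y ∈ comSpace d m)
    (hB : ∀ C : CollisionClusters n, F.B C.1 y ≠ 0) (ht : ∀ l < F.k, 0 < F.t l y) :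
    F.A 0 y ∈ noncollision d m := by
  refine (mem_noncollision_iff hm).mpr ⟨F.A_zero_mem hm hy, fun C => ?_⟩
  rw [F.projI_A_zero_eq hm C.2]
  exact smul_ne_zero (F.scale_pos fun i hi => ht i (hi.trans_le (F.lev_le C.2))).ne' (hB C)

theorem param_mem_totalBlowUp (hm : ∀ i, 0 < m i) {y : Config n d} (hy : y ∈ comSpace d m)
    (hB : ∀ C : CollisionClusters n, F.B C.1 y ≠ 0) (ht : ∀ l < F.k, 0 ≤ F.t l y) :
    F.param y ∈ totalBlowUp d m := by
  refine ⟨fun C => F.param_mem_blowUp hm hy ht C (hB C), ?_⟩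
  -- By orthonormality, adding ε e raises every scale coordinate by ε. This exhibits `F.param y` as
  -- a limit of images of noncollision configurations.
  let e : Config n d := ∑ l ∈ Finset.range F.k, F.v l
  have he : e ∈ comSpace d m := (comSubmodule d m).sum_mem fun l hl =>
    F.v_mem hm (Finset.mem_range.mp hl)
  have hte : ∀ l < F.k, massInner m e (F.v l) = 1 := fun l hl => by
    rw [massInner_sum_left, Finset.sum_congr rfl fun i hi =>
      F.massInner_v_v hm (Finset.mem_range.mp hi) hl]
    simp [hl]
  let z : ℝ → Config n d := fun ε => y + ε • e
  have hz : Continuous z := by fun_prop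
  have hz0 : z 0 = y := by simp [z]
  have hzB : ∀ᶠ ε in 𝓝[>] (0 : ℝ), ∀ C : CollisionClusters n, F.B C.1 (z ε) ≠ 0 := by
    refine Filter.eventually_all.mpr fun C => Filter.Eventually.filter_mono nhdsWithin_le_nhds ?_
    have : ContinuousAt (fun ε => F.B C.1 (z ε)) 0 :=
      ((F.contDiff_B C.1).continuous.comp hz).continuousAt
    exact this.eventually_ne (by rw [hz0]; exact hB C)
  have hlim : Filter.Tendsto (fun ε => F.param (z ε)) (𝓝[>] 0) (𝓝 (F.param y)) := by
    have h1 : ContinuousAt F.param (z 0) := by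
      rw [hz0]; exact (F.contDiffAt_param hm hB).continuousAt
    have := (ContinuousAt.comp h1 hz.continuousAt).tendsto
    simp only [Function.comp_apply, hz0] at this
    exact this.mono_left nhdsWithin_le_nhds
  refine mem_closure_of_tendsto hlim ?_
  filter_upwards [hzB, self_mem_nhdsWithin] with ε hε hpos
  have hpos : 0 < ε := hpos
  have hzc : z ε ∈ comSpace d m :=
    (comSubmodule d m).add_mem hy ((comSubmodule d m).smul_mem ε he)
  have htz : ∀ l < F.k, 0 < F.t l (z ε) := fun l hl => by
    have h1 : F.t l (z ε) = F.t l y + ε := by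
      simp only [t, z, massInner_add_left, massInner_smul_left, hte l hl, mul_one]
    rw [h1]
    exact add_pos_of_nonneg_of_pos (ht l hl) hpos
  exact ⟨F.A 0 (z ε), F.A_zero_mem_noncollision hm hzc hε htz,
    (F.param_eq_diagonalMap hm htz).symm⟩

/-- A vanishing t l makes the radius in the component D l zero, while noncollision configurations
have positive radii. -/
theorem param_ne_diagonalMap (hm : ∀ i, 0 < m i) {y : Config n d} {l : ℕ} (hl : l < F.k)
    (ht : F.t l y = 0) {q : Config n d} (hq : q ∈ noncollision d m) :
    F.param y ≠ diagonalMap m q := by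
  intro h
  have h1 := congrArg (fun x => (x ⟨F.D l, F.D_ne_bot hm hl⟩).2.1) h
  have h2 := sqrt_massInner_pos hm (((mem_noncollision_iff hm).mp hq).2 ⟨F.D l, F.D_ne_bot hm hl⟩)
  have h3 : F.scale (F.lev (F.D l)) y = 0 := by
    rw [F.lev_D hm hl]
    exact Finset.prod_eq_zero (Finset.self_mem_range_succ l) ht
  simp only [param, h3, zero_mul, diagonalMap] at h1
  exact h2.ne h1

end Flag

end LocalCharts

/-! ### The potential in the charts. -/

section Potential

variable {n d : ℕ} {m : Fin n → ℝ}

namespace Flag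

variable (F : Flag d m)

/-- The difference vector of two particles, in the scale at which it is seen. -/
noncomputable def gap (i j : Fin n) (y : Config n d) : EuclideanSpace ℝ (Fin d) :=
  F.A (F.lev (pairPart i j)) y i - F.A (F.lev (pairPart i j)) y j

/-- The barycentre of the cluster {i, j} drops out of the difference, which therefore obeys the
scaling law of `projI_A_zero_eq` for the pair partition. -/
theorem A_zero_sub (hm : ∀ i, 0 < m i) {i j : Fin n} (hij : i ≠ j) (y : Config n d) :
    F.A 0 y i - F.A 0 y j = F.scale (F.lev (pairPart i j)) y • F.gap i j y := by
  have hpart := pairPart_part_eq i j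
  have h := F.projI_A_zero_eq hm (pairPart_ne_bot hij) y
  have hi := congrFun h i
  have hj := congrFun h j
  simp only [B, projI, Pi.sub_apply, Pi.smul_apply] at hi hj
  rw [projE_const hpart, projE_const hpart (F.A (F.lev (pairPart i j)) y)] at hi
  have := congrArg₂ (· - ·) hi hj
  simpa [gap, ← smul_sub] using this

theorem gap_ne_zero (hm : ∀ i, 0 < m i) {i j : Fin n} (hij : i ≠ j) {y : Config n d}
    (hB : ∀ C : CollisionClusters n, F.B C.1 y ≠ 0) : F.gap i j y ≠ 0 := fun h =>
  hB ⟨pairPart i j, pairPart_ne_bot hij⟩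
    ((projI_pairPart_eq_zero_iff hm).mpr (sub_eq_zero.mp h))

/-- The potential in the scale of the tightest cluster, as a function of the `α`-th powers of
the scale coordinates and of the parameters. -/
noncomputable def scaledPotential (Z : Fin n → Fin n → ℝ) (α : ℝ) (s : Fin F.k → ℝ)
    (y : Config n d) : ℝ :=
  ∑ i, ∑ j with i < j, Z i j *
    (∏ r : Fin F.k, if F.lev (pairPart i j) ≤ r then s r else 1) * (‖F.gap i j y‖ ^ α)⁻¹

variable {Z : Fin n → Fin n → ℝ} {α : ℝ}

theorem scale_k_rpow {l : ℕ} (hl : l ≤ F.k) {y : Config n d} (ht : ∀ r < F.k, 0 < F.t r y) :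
    F.scale F.k y ^ α = F.scale l y ^ α *
      ∏ r : Fin F.k, if l ≤ r then F.t r y ^ α else 1 := by
  rw [Fin.prod_univ_eq_prod_range (fun r => if l ≤ r then F.t r y ^ α else 1),
    ← Finset.prod_range_mul_prod_Ico _ hl, Finset.prod_eq_one fun r hr => if_neg
      (Finset.mem_range.mp hr).not_ge, one_mul,
    Finset.prod_congr rfl fun r hr => if_pos (Finset.mem_Ico.mp hr).1,
    Real.finsetProd_rpow _ _ fun r hr => (ht r (Finset.mem_Ico.mp hr).2).le,
    ← Real.mul_rpow, scale, scale, Finset.prod_range_mul_prod_Ico _ hl]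
  · exact (F.scale_pos fun r hr => ht r (hr.trans_le hl)).le
  · exact Finset.prod_nonneg fun r hr => (ht r (Finset.mem_Ico.mp hr).2).le

/-- A pair of level l contributes scale l to the power -α; extracting the full scale k leaves the
factors t r ^ α with r ≥ l. -/
theorem potential_A_zero (hm : ∀ i, 0 < m i) {y : Config n d}
    (ht : ∀ r < F.k, 0 < F.t r y) :
    potential Z α (F.A 0 y)
      = (F.scale F.k y ^ α)⁻¹ * F.scaledPotential Z α (fun r => F.t r y ^ α) y := by
  rw [potential, scaledPotential, Finset.mul_sum]
  refine Finset.sum_congr rfl fun i _ => ?_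
  rw [Finset.mul_sum]
  refine Finset.sum_congr rfl fun j hj => ?_
  have hij : i ≠ j := (Finset.mem_filter.mp hj).2.ne
  have hl := F.lev_le (pairPart_ne_bot hij)
  have hs := F.scale_pos (l := F.lev (pairPart i j)) fun r hr => ht r (hr.trans_le hl)
  have hp : (∏ r : Fin F.k, if F.lev (pairPart i j) ≤ r then F.t r y ^ α else 1) ≠ 0 :=
    (Finset.prod_pos fun r _ => by
      split_ifs
      · exact Real.rpow_pos_of_pos (ht r r.2) α
      · exact one_pos).ne'
  rw [F.A_zero_sub hm hij, norm_smul, Real.norm_of_nonneg hs.le,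
    Real.mul_rpow hs.le (norm_nonneg _), F.scale_k_rpow hl ht]
  have := (Real.rpow_pos_of_pos hs α).ne'
  rw [div_eq_mul_inv, mul_inv, mul_inv]
  field_simp

theorem scaledPotential_term_nonneg (hZ : ∀ i j, i < j → 0 < Z i j) {s : Fin F.k → ℝ}
    (hs : ∀ r, 0 ≤ s r) (y : Config n d) {i j : Fin n} (hij : i < j) :
    0 ≤ Z i j * (∏ r : Fin F.k, if F.lev (pairPart i j) ≤ r then s r else 1) *
      (‖F.gap i j y‖ ^ α)⁻¹ := by
  refine mul_nonneg (mul_nonneg (hZ i j hij).le (Finset.prod_nonneg fun r _ => ?_))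
    (inv_nonneg.mpr (Real.rpow_nonneg (norm_nonneg _) _))
  split_ifs
  · exact hs r
  · exact zero_le_one

theorem potential_rpow_A_zero (hm : ∀ i, 0 < m i) (hZ : ∀ i j, i < j → 0 < Z i j) (hα : 0 < α)
    {y : Config n d} (ht : ∀ r < F.k, 0 < F.t r y) :
    potential Z α (F.A 0 y) ^ (-1 / α) = (∏ r : Fin F.k, F.t r y) *
      F.scaledPotential Z α (fun r => F.t r y ^ α) y ^ (-1 / α) := by
  have hs : 0 < F.scale F.k y := F.scale_pos ht
  have h0 : 0 ≤ F.scaledPotential Z α (fun r => F.t r y ^ α) y :=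
    Finset.sum_nonneg fun i _ => Finset.sum_nonneg fun j hj =>
      F.scaledPotential_term_nonneg hZ (fun r => (Real.rpow_pos_of_pos (ht r r.2) α).le) y
        (Finset.mem_filter.mp hj).2
  rw [F.potential_A_zero hm ht, Real.mul_rpow (inv_nonneg.mpr (Real.rpow_nonneg hs.le _)) h0,
    ← Real.rpow_neg hs.le, ← Real.rpow_mul hs.le, show -α * (-1 / α) = 1 by field_simp,
    Real.rpow_one, Fin.prod_univ_eq_prod_range (fun r => F.t r y), ← scale]

/-- For k > 0 the last nontrivial partition D (k - 1) still joins some pair; for k = 0 every pair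
has level 0. -/
theorem exists_lev_pairPart_eq (hn : 2 ≤ n) (hm : ∀ i, 0 < m i) :
    ∃ i j : Fin n, i < j ∧ F.lev (pairPart i j) = F.k := by
  rcases h : F.k with _ | k
  · have hij : (⟨0, by omega⟩ : Fin n) < ⟨1, by omega⟩ := by simp
    refine ⟨_, _, hij, ?_⟩
    have := F.lev_le (pairPart_ne_bot hij.ne)
    omega
  · obtain ⟨i, j, hij, hp⟩ := exists_part_eq_of_ne_bot (F.D_ne_bot hm (show k < F.k by omega))
    refine ⟨i, j, hij, le_antisymm (h ▸ F.lev_le (pairPart_ne_bot hij.ne)) ?_⟩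
    by_contra hlt
    exact F.not_le_D_lev (pairPart_ne_bot hij.ne)
      ((pairPart_le_iff.mpr hp).trans (F.antitone (by omega)))

/-- All terms are nonnegative, and a pair of level k carries no factor s r, so its term stays
positive at s = 0. -/
theorem scaledPotential_pos (hn : 2 ≤ n) (hm : ∀ i, 0 < m i) (hZ : ∀ i j, i < j → 0 < Z i j)
    {y : Config n d} (hB : ∀ C : CollisionClusters n, F.B C.1 y ≠ 0) :
    0 < F.scaledPotential Z α 0 y := by
  have hnn : ∀ i j : Fin n, i < j → _ := fun i j hij =>
    F.scaledPotential_term_nonneg (α := α) hZ (s := 0) (fun _ => le_rfl) y hij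
  obtain ⟨i, j, hij, hl⟩ := F.exists_lev_pairPart_eq hn hm
  refine Finset.sum_pos' (fun i _ => Finset.sum_nonneg fun j hj =>
    hnn i j (Finset.mem_filter.mp hj).2) ⟨i, Finset.mem_univ i, ?_⟩
  refine Finset.sum_pos' (fun j hj => hnn i j (Finset.mem_filter.mp hj).2)
    ⟨j, by simp [hij], ?_⟩
  rw [Finset.prod_eq_one fun r _ => if_neg (by have := r.2; omega), mul_one]
  exact mul_pos (hZ i j hij)
    (inv_pos.mpr (Real.rpow_pos_of_pos (norm_pos_iff.mpr (F.gap_ne_zero hm hij.ne hB)) α))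

theorem contDiffAt_scaledPotential (hm : ∀ i, 0 < m i) {z : (Fin F.k → ℝ) × Config n d}
    (hB : ∀ C : CollisionClusters n, F.B C.1 z.2 ≠ 0) :
    ContDiffAt ℝ ∞ (fun z : (Fin F.k → ℝ) × Config n d => F.scaledPotential Z α z.1 z.2) z := by
  refine ContDiffAt.sum fun i _ => ContDiffAt.sum fun j hj => ?_
  have hij : i ≠ j := (Finset.mem_filter.mp hj).2.ne
  have hg := F.gap_ne_zero hm hij hB
  have hgap : ContDiffAt ℝ ∞ (fun z : (Fin F.k → ℝ) × Config n d => F.gap i j z.2) z := by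
    have hA := (F.contDiff_A (F.lev (pairPart i j))).comp
      (contDiff_snd (E := Fin F.k → ℝ) (F := Config n d))
    exact ((contDiff_pi.mp hA i).sub (contDiff_pi.mp hA j)).contDiffAt
  have hgα : ContDiffAt ℝ ∞
      (fun z : (Fin F.k → ℝ) × Config n d => (‖F.gap i j z.2‖ ^ α)⁻¹) z :=
    ((hgap.norm ℝ hg).rpow_const_of_ne (norm_ne_zero_iff.mpr hg)).inv
      (Real.rpow_pos_of_pos (norm_pos_iff.mpr hg) α).ne'
  refine (contDiffAt_const.mul (contDiffAt_prod fun r _ => ?_)).mul hgα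
  split_ifs
  · exact ((contDiff_apply ℝ ℝ r).comp contDiff_fst).contDiffAt
  · exact contDiffAt_const

end Flag

/-- The noncollision configurations, as a subset of the blow-up. -/
def blowUpInterior (d : ℕ) (m : Fin n → ℝ) : Set (totalBlowUp d m) :=
  {p | ∃ q ∈ noncollision d m, p = diagonalMap m q}

/-- The chart comes from the flag of p: its inverse is `param` in orthonormal coordinates of M that
begin with the scales, and the chart itself is `recon` of `seen`. -/
theorem hasCornerForm (hn : 2 ≤ n) (hm : ∀ i, 0 < m i) {Z : Fin n → Fin n → ℝ}
    (hZ : ∀ i j, i < j → 0 < Z i j) {α : ℝ} (hα : 0 < α) {ρ : totalBlowUp d m → ℝ}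
    (hρ : ∀ q ∈ noncollision d m, ∀ p : totalBlowUp d m,
      (p : CollisionClusters n → BlowUpAmbient n d) = diagonalMap m q →
        ρ p = potential Z α q ^ (-1 / α)) :
    HasCornerForm ((n - 1) * d) (blowUpInterior d m) α ρ := by
  intro p
  -- Any component can be used to read off the blow-down; one exists because n ≥ 2.
  let C₀ : CollisionClusters n := ⟨pairPart ⟨0, by omega⟩ ⟨1, by omega⟩,
    pairPart_ne_bot (by simp)⟩
  obtain ⟨F, hbase, hv⟩ := exists_flag hm C₀ p.2
  obtain ⟨hk, L, P, hLc, hPL, hLP, hcoord⟩ := exists_orthonormal_coordinates (by omega) hm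
    (fun i hi => F.v_mem hm hi) (fun i hi j hj => F.massInner_v_v hm hi hj)
  have hL : ContDiff ℝ ∞ L := L.toContinuousLinearMap.contDiff
  have hPc : ContDiff ℝ ∞ P := P.toContinuousLinearMap.contDiff
  have ht : ∀ y, ∀ i : Fin ((n - 1) * d), (i : ℕ) < F.k → F.t i (L y) = y i := hcoord
  have ht' : ∀ y : EuclideanSpace ℝ (Fin ((n - 1) * d)), ∀ l (hl : l < F.k),
      F.t l (L y) = y ⟨l, hl.trans_le hk⟩ := fun y l hl => ht y ⟨l, hl.trans_le hk⟩ hl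
  let f : (CollisionClusters n → BlowUpAmbient n d) → EuclideanSpace ℝ (Fin ((n - 1) * d)) :=
    fun x => P (F.recon (F.seen C₀ x))
  let g : EuclideanSpace ℝ (Fin ((n - 1) * d)) → CollisionClusters n → BlowUpAmbient n d :=
    fun y => F.param (L y)
  let O := F.chartDomain C₀
  let W : Set (EuclideanSpace ℝ (Fin ((n - 1) * d))) :=
    {y | ∀ C : CollisionClusters n, F.B C.1 (L y) ≠ 0}
  have hO : IsOpen O := F.isOpen_chartDomain C₀
  have hW : IsOpen W := by
    have : W = ⋂ C : CollisionClusters n, {y | F.B C.1 (L y) ≠ 0} := by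
      ext y; simp [W]
    rw [this]
    exact isOpen_iInter_of_finite fun C =>
      isOpen_ne_fun ((F.contDiff_B C.1).comp hL).continuous continuous_const
  have hf : ContDiffOn ℝ ∞ f O := hPc.comp_contDiffOn (F.contDiffOn_recon_seen C₀)
  have hg : ContDiffOn ℝ ∞ g W := fun y hy =>
    (ContDiffAt.comp y (F.contDiffAt_param hm hy) hL.contDiffAt).contDiffWithinAt
  have hcone : IsClosed (cornerModel ((n - 1) * d) F.k) := by
    have : cornerModel ((n - 1) * d) F.k = ⋂ i : Fin ((n - 1) * d), ⋂ _ : (i : ℕ) < F.k,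
        {x : EuclideanSpace ℝ (Fin ((n - 1) * d)) | 0 ≤ x i} := by
      ext x; simp [cornerModel]
    rw [this]
    exact isClosed_iInter fun i => isClosed_iInter fun _ =>
      isClosed_le continuous_const (EuclideanSpace.proj (𝕜 := ℝ) i).continuous
  have hdiag : ∀ q ∈ noncollision d m, diagonalMap m q ∈ O →
      f (diagonalMap m q) ∈ cornerModel ((n - 1) * d) F.k ∧
        g (f (diagonalMap m q)) = diagonalMap m q := by
    intro q hq hqO
    obtain ⟨h1, h2, h3⟩ := F.recon_seen_diagonalMap hm C₀ hq hqO
    have h4 : L (f (diagonalMap m q)) = F.recon (F.seen C₀ (diagonalMap m q)) := hLP _ h1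
    refine ⟨fun i hi => ?_, ?_⟩
    · rw [← ht _ i hi, h4]
      exact (h2 i hi).le
    · change F.param (L (f (diagonalMap m q))) = _
      rw [h4, h3]
  -- Both assertions hold on the image of the noncollision configurations. They pass to its closure
  -- because the corner model is closed and f and g are continuous.
  have hfg : ∀ x ∈ totalBlowUp d m, x ∈ O → f x ∈ W →
      f x ∈ cornerModel ((n - 1) * d) F.k ∧ g (f x) = x := by
    intro x hx hxO hxW
    have hne : (𝓝[diagonalMap m '' noncollision d m] x).NeBot :=
      mem_closure_iff_nhdsWithin_neBot.mp hx.2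
    have hfx : ContinuousAt f x := hf.continuousOn.continuousAt (hO.mem_nhds hxO)
    have hgx : ContinuousAt g (f x) := hg.continuousOn.continuousAt (hW.mem_nhds hxW)
    have hev : ∀ᶠ z in 𝓝[diagonalMap m '' noncollision d m] x,
        f z ∈ cornerModel ((n - 1) * d) F.k ∧ g (f z) = z := by
      filter_upwards [self_mem_nhdsWithin, mem_nhdsWithin_of_mem_nhds (hO.mem_nhds hxO)] with z hz hzO
      obtain ⟨q, hq, rfl⟩ := hz
      exact hdiag q hq hzO
    refine ⟨hcone.mem_of_tendsto (hfx.tendsto.mono_left nhdsWithin_le_nhds)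
      (hev.mono fun z hz => hz.1), ?_⟩
    have h1 : Filter.Tendsto (g ∘ f) (𝓝[diagonalMap m '' noncollision d m] x) (𝓝 (g (f x))) :=
      (ContinuousAt.comp hgx hfx).tendsto.mono_left nhdsWithin_le_nhds
    have h2 : Filter.Tendsto (g ∘ f) (𝓝[diagonalMap m '' noncollision d m] x) (𝓝 x) :=
      Filter.Tendsto.congr' (hev.mono fun z hz => hz.2.symm)
        (Filter.tendsto_id.mono_left nhdsWithin_le_nhds)
    exact tendsto_nhds_unique h1 h2
  have hgf : ∀ y ∈ W, y ∈ cornerModel ((n - 1) * d) F.k →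
      g y ∈ totalBlowUp d m ∧ g y ∈ O ∧ f (g y) = y := by
    intro y hy hyc
    obtain ⟨h1, h2⟩ := F.seen_param hm C₀ hy
    refine ⟨F.param_mem_totalBlowUp hm (hLc y) hy fun l hl => ?_, h1, ?_⟩
    · rw [ht' y l hl]
      exact hyc _ hl
    · change P (F.recon (F.seen C₀ (F.param (L y)))) = y
      rw [F.recon_A hm h2, hPL]
  obtain ⟨φ, hsource, htarget, hφ, hφsymm⟩ := exists_cornerChart hO hW hf hg hfg hgf ⟨p, p.2⟩
  have hpv : ∀ l < F.k, (p.1 (F.idx C₀ l)).2.2 = F.v l := fun l hl => by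
    rw [F.idx_eq hm C₀ hl, hv l hl]
  have hpO : (p : CollisionClusters n → BlowUpAmbient n d) ∈ O := fun l hl => by
    rw [hpv l hl, F.massInner_v l hl]
    exact one_pos
  -- At p the normalizing factors are ⟨v l, v l⟩ = 1, so what is seen is the base and the v l, the
  -- values of A at the base point.
  have hrecon : F.recon (F.seen C₀ p) = F.base := by
    refine F.recon_A hm fun l hl => ?_
    rcases l with _ | l
    · rw [F.A_zero_base hm, hbase]; rfl
    · rw [Flag.seen, hpv l hl, F.massInner_v l hl, inv_one, one_smul, F.A_succ_base hm hl]
  have hLf : L (f p) = F.base := by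
    change L (P (F.recon (F.seen C₀ p))) = _
    rw [hrecon, hLP _ F.base_mem]
  have hpW : f p ∈ W := fun C => by
    rw [hLf]; exact F.B_base_ne hm C.2
  have hp : p ∈ φ.toHomeo.source := (hsource p).mpr ⟨hpO, hpW⟩
  have hφp : (φ.toHomeo p : EuclideanSpace ℝ (Fin ((n - 1) * d))) = f p := hφ p hp
  have hinterior : ∀ y ∈ φ.toHomeo.target,
      (∀ i : Fin ((n - 1) * d), (i : ℕ) < F.k →
        0 < (y : EuclideanSpace ℝ (Fin ((n - 1) * d))) i) →
      F.A 0 (L y) ∈ noncollision d m ∧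
        (φ.toHomeo.symm y : CollisionClusters n → BlowUpAmbient n d)
          = diagonalMap m (F.A 0 (L y)) := by
    intro y hy hpos
    have htpos : ∀ l < F.k, 0 < F.t l (L y) := fun l hl => by
      rw [ht' y l hl]; exact hpos _ hl
    exact ⟨F.A_zero_mem_noncollision hm (hLc y) ((htarget y).mp hy) htpos,
      (hφsymm y hy).trans (F.param_eq_diagonalMap hm htpos)⟩
  have hI : ∀ y ∈ φ.toHomeo.target, φ.toHomeo.symm y ∈ blowUpInterior d m ↔
      ∀ i : Fin ((n - 1) * d), (i : ℕ) < F.k →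
        0 < (y : EuclideanSpace ℝ (Fin ((n - 1) * d))) i := by
    intro y hy
    constructor
    · rintro ⟨q, hq, hqy⟩ i hi
      refine lt_of_le_of_ne (y.2 i hi) fun h0 => ?_
      rw [hφsymm y hy] at hqy
      exact F.param_ne_diagonalMap hm hi (by rw [ht _ i hi, ← h0]) hq hqy
    · intro hpos
      exact ⟨_, hinterior y hy hpos⟩
  refine ⟨F.k, hk, φ, hp, fun i hi => ?_, hI,
    fun z => F.scaledPotential Z α z.1 (L z.2) ^ (-1 / α), ?_, ?_, ?_⟩
  · rw [hφp, ← ht _ i hi, hLf, F.t_base hm hi]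
  · have hS : ∀ z : (Fin F.k → ℝ) × EuclideanSpace ℝ (Fin ((n - 1) * d)), z.2 ∈ W →
        ContDiffAt ℝ ∞ (fun z : (Fin F.k → ℝ) × EuclideanSpace ℝ (Fin ((n - 1) * d)) =>
          F.scaledPotential Z α z.1 (L z.2)) z := fun z hz =>
      ContDiffAt.comp z (g := fun z : (Fin F.k → ℝ) × Config n d => F.scaledPotential Z α z.1 z.2)
        (f := fun z : (Fin F.k → ℝ) × EuclideanSpace ℝ (Fin ((n - 1) * d)) => (z.1, L z.2))
        (F.contDiffAt_scaledPotential hm hz)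
        (contDiffAt_fst.prodMk (hL.contDiffAt.comp z contDiffAt_snd))
    rw [hφp]
    have hW' : ∀ᶠ z in 𝓝 ((0, f p) : (Fin F.k → ℝ) × EuclideanSpace ℝ (Fin ((n - 1) * d))),
        z.2 ∈ W := continuousAt_snd (hW.mem_nhds hpW)
    have hpos := (hS (0, f p) hpW).continuousAt.eventually_ne
      (F.scaledPotential_pos hn hm hZ hpW).ne'
    filter_upwards [hW', hpos] with z hz hz0
    exact (hS z hz).rpow_const_of_ne hz0
  · rw [hφp]
    exact Real.rpow_pos_of_pos (F.scaledPotential_pos hn hm hZ hpW) _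
  · refine Filter.Eventually.of_forall fun y hyc hyt hyI => ?_
    have hpos := (hI _ hyt).mp hyI
    obtain ⟨hq, hqy⟩ := hinterior _ hyt hpos
    have htr : ∀ r : Fin F.k, F.t r (L y) = y (Fin.castLE hk r) := fun r =>
      ht y (Fin.castLE hk r) r.2
    rw [hρ _ hq _ hqy, F.potential_rpow_A_zero hm hZ hα fun l hl => by
      rw [ht' y l hl]; exact hpos _ hl]
    simp only [htr]

theorem potential_pos (hn : 2 ≤ n) {Z : Fin n → Fin n → ℝ} (hZ : ∀ i j, i < j → 0 < Z i j)
    (α : ℝ) {q : Config n d} (hq : q ∈ noncollision d m) : 0 < potential Z α q := by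
  have hterm : ∀ i j : Fin n, i < j → 0 < Z i j / ‖q i - q j‖ ^ α := fun i j hij =>
    div_pos (hZ i j hij)
      (Real.rpow_pos_of_pos (norm_pos_iff.mpr (sub_ne_zero.mpr (hq.2 i j hij.ne))) α)
  refine Finset.sum_pos' (fun i _ => Finset.sum_nonneg fun j hj =>
    (hterm i j (Finset.mem_filter.mp hj).2).le) ⟨⟨0, by omega⟩, Finset.mem_univ _, ?_⟩
  exact Finset.sum_pos (fun j hj => hterm _ j (Finset.mem_filter.mp hj).2)
    ⟨⟨1, by omega⟩, by simp⟩

theorem diagonalMap_injective (hn : 2 ≤ n) (hm : ∀ i, 0 < m i) :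
    Function.Injective (diagonalMap m : Config n d → _) := fun p q h => by
  let C₀ : CollisionClusters n := ⟨pairPart ⟨0, by omega⟩ ⟨1, by omega⟩,
    pairPart_ne_bot (by simp)⟩
  rw [← blowDown_diagonalMap hm C₀ p, h, blowDown_diagonalMap hm C₀ q]

end Potential

end NBody

/-! ### Existence, uniqueness and regularity of ρ. -/

open NBody
theorem lemma3p3 (n d : ℕ) (hn : 2 ≤ n)
    (m : Fin n → ℝ) (hm : ∀ i, 0 < m i)
    (Z : Fin n → Fin n → ℝ) (hZ : ∀ i j, i < j → 0 < Z i j)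
    (α : ℝ) (hα : 0 < α) :
    -- the total boundary blow-up is a manifold with corners, and the complement of its boundary
    -- is the noncollision configuration space
    IsManifoldWithCorners ((n - 1) * d) (totalBlowUp d m) ∧
    (∀ p : totalBlowUp d m, p ∉ cornerBoundary ((n - 1) * d) (totalBlowUp d m) ↔
      ∃ q ∈ noncollision d m, p = diagonalMap m q) ∧
    -- hence the prescription defines exactly one function, and it has the claimed properties
    (∃! ρ : totalBlowUp d m → ℝ, IsRho m Z α ρ) ∧
    ∀ ρ : totalBlowUp d m → ℝ, IsRho m Z α ρ →
      IsHolderOnCorners (1 + α) ((n - 1) * d) ρ ∧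
      (α = 1 → IsBoundaryDefiningFunction ((n - 1) * d) ρ) := by
  classical
  let ρ₀ : totalBlowUp d m → ℝ := fun p =>
    if h : ∃ q ∈ noncollision d m, p = diagonalMap m q then potential Z α h.choose ^ (-1 / α) else 0
  have hρ₀ : ∀ q ∈ noncollision d m, ∀ p : totalBlowUp d m,
      (p : CollisionClusters n → BlowUpAmbient n d) = diagonalMap m q →
        ρ₀ p = potential Z α q ^ (-1 / α) := by
    intro q hq p hpq
    have h : ∃ q ∈ noncollision d m, p = diagonalMap m q := ⟨q, hq, hpq⟩
    simp only [ρ₀, dif_pos h]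
    -- Injectivity of the diagonal map identifies the chosen preimage with q, so `ρ₀` does not
    -- depend on the choice.
    rw [diagonalMap_injective hn hm (h.choose_spec.2.symm.trans hpq)]
  have hform := hasCornerForm hn hm hZ hα hρ₀
  have hbd : ∀ p : totalBlowUp d m, p ∉ cornerBoundary ((n - 1) * d) (totalBlowUp d m) ↔
      ∃ q ∈ noncollision d m, p = diagonalMap m q := hform.notMem_cornerBoundary_iff
  refine ⟨hform.isManifoldWithCorners, hbd, ⟨ρ₀, ⟨hρ₀, fun p hp => ?_⟩, fun ρ hρ => ?_⟩,
    fun ρ hρ => ?_⟩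
  · exact dif_neg fun h => (hbd p).mpr h hp
  · funext p
    by_cases h : ∃ q ∈ noncollision d m, p = diagonalMap m q
    · obtain ⟨q, hq, hpq⟩ := h
      rw [hρ.1 q hq p hpq, hρ₀ q hq p hpq]
    · rw [hρ.2 p (by_contra fun hp => h ((hbd p).mp hp))]
      exact (show ρ₀ p = 0 from dif_neg h).symm
  · have hformρ := hasCornerForm hn hm hZ hα hρ.1
    have h0 : ∀ p, p ∉ blowUpInterior d m → ρ p = 0 := fun p hp =>
      hρ.2 p (by_contra fun h => hp ((hbd p).mp h))
    refine ⟨hformρ.isHolderOnCorners hα h0, ?_⟩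
    rintro rfl
    refine hformρ.isBoundaryDefiningFunction h0 ?_
    rintro p ⟨q, hq, hpq⟩
    rw [hρ.1 q hq p hpq]
    exact Real.rpow_pos_of_pos (potential_pos hn hZ 1 hq) _
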